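/- Let $p$ be a prime. Let $L_t\cup P$ be the one-sorted language $\{0,1,+,\cdot,t\}$ together with a unary predicate $P$, and view each ring $\mathbb{F}_p[t]/(t^n)$, $n\in\mathbb{N}$, as an $L_t\cup P$-structure in which the constant $t$ is the class of $t$ and $P$ is the set $\{0,1,t,\dots,t^{n-1}\}$. Let $L_{\mathrm{val},\times}$ be the three-sorted language of valued fields with a cross-section: sorts $\mathbf{K}$ (field) and $\mathbf{k}$ (residue field), each with symbols $0,1,+,\cdot$; a sort $\mathbf{\Gamma}$ (value group together with $\infty$) with symbols $0,+,<,\infty$; and function symbols $v:\mathbf{K}\to\mathbf{\Gamma}$ for the valuation, $\mathrm{res}:\mathbf{K}\to\mathbf{k}$ for the residue map (with $\mathrm{res}(x)=0$ if $v(x)<0$) and $s:\mathbf{\Gamma}\to\mathbf{K}$ for a cross-section, that is, a group homomorphism $s:\Gamma\to K^\times$ with $v\circ s=\mathrm{id}_\Gamma$, extended by $s(\infty)=0$. For every totally ramified finite extension $K/\mathbb{Q}_p$ inside a fixed algebraic closure of $\mathbb{Q}_p$, that is, $[K:\mathbb{Q}_p]=e(K/\mathbb{Q}_p)<\infty$,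 fix an arbitrary cross-section $s_K$, and view $K$, equipped with $s_K$, as an $L_{\mathrm{val},\times}$-structure. Then the set of existential $L_t\cup P$-sentences that are true in $\mathbb{F}_p[t]/(t^n)$ for all but finitely many $n\in\mathbb{N}$ is Turing reducible to the set of $\exists\forall$-sentences of $L_{\mathrm{val},\times}$ that are true in all but finitely many totally ramified finite extensions $K$ of $\mathbb{Q}_p$. Here an existential sentence (respectively an $\exists\forall$-sentence) is a sentence consisting of a block of existential quantifiers (respectively a block of existential quantifiers followed by a block of universal quantifiers) in front of a quantifier-free formula, where blocks may be empty, and sentences are identified with natural numbers through standard Gödel numberings. -/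

import Mathlib

open FirstOrder

/-! ## The one-sorted language `L_t ∪ {P}` and the rings `𝔽_p[t]/(t^n)` -/

/-- Function symbols of `L_t = {0, 1, +, ·, t}`. -/
inductive LtFunc : ℕ → Type
  | zero : LtFunc 0
  | one : LtFunc 0
  | t : LtFunc 0
  | add : LtFunc 2
  | mul : LtFunc 2

/-- The unary predicate symbol `P`. -/
inductive LtRel : ℕ → Type
  | P : LtRel 1

/-- The language `L_t ∪ {P}`. -/
def LtP : FirstOrder.Language.{0, 0} := ⟨LtFunc, LtRel⟩

/-- The ring `𝔽_p[t]/(t^n)`. -/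
abbrev TruncPoly (p n : ℕ) : Type :=
  Polynomial (ZMod p) ⧸ Ideal.span {(Polynomial.X : Polynomial (ZMod p)) ^ n}

/-- The class of `t` in `𝔽_p[t]/(t^n)`. -/
noncomputable def TruncPoly.t (p n : ℕ) : TruncPoly p n :=
  Ideal.Quotient.mk _ Polynomial.X

/-- `𝔽_p[t]/(t^n)` as an `L_t ∪ {P}`-structure, `P` being the set `{0, 1, t, …, t^(n-1)}`. -/
noncomputable instance TruncPoly.structure (p n : ℕ) : LtP.Structure (TruncPoly p n) where
  funMap := fun f => match f with
    | LtFunc.zero => fun _ => 0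
    | LtFunc.one => fun _ => 1
    | LtFunc.t => fun _ => TruncPoly.t p n
    | LtFunc.add => fun x => x 0 + x 1
    | LtFunc.mul => fun x => x 0 * x 1
  RelMap := fun r => match r with
    | LtRel.P => fun x => x 0 = 0 ∨ ∃ k < n, x 0 = TruncPoly.t p n ^ k

/-- The asymptotic existential theory of `{𝔽_p[t]/(t^n) : n ∈ ℕ}`: the existential
`L_t ∪ {P}`-sentences that are true in `𝔽_p[t]/(t^n)` for all but finitely many `n`. -/
def asymptoticExistentialTheory (p : ℕ) : Set LtP.Sentence :=
  {φ | FirstOrder.Language.BoundedFormula.IsExistential φ ∧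
    ∀ᶠ n : ℕ in Filter.cofinite, TruncPoly p n ⊨ φ}

namespace LtP

/-! Gödel numbering of `L_t ∪ {P}`. -/

def funcCode : {l : ℕ} → LtFunc l → ℕ
  | _, LtFunc.zero => 0
  | _, LtFunc.one => 1
  | _, LtFunc.t => 2
  | _, LtFunc.add => 3
  | _, LtFunc.mul => 4

def termCode {n : ℕ} : LtP.Term (Empty ⊕ Fin n) → ℕ
  | .var (Sum.inl e) => e.elim
  | .var (Sum.inr i) => Nat.pair 0 i
  | .func f ts =>
      Nat.pair 1 (Nat.pair (funcCode f) (Encodable.encode (List.ofFn fun i => termCode (ts i))))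

/-- Variables are de Bruijn levels, as in `BoundedFormula`. `P` is the only relation symbol, so
its atoms are coded by their list of arguments alone. -/
def code : {n : ℕ} → LtP.BoundedFormula Empty n → ℕ
  | _, .falsum => Nat.pair 0 0
  | _, .equal t₁ t₂ => Nat.pair 1 (Nat.pair (termCode t₁) (termCode t₂))
  | _, .rel _ ts => Nat.pair 2 (Encodable.encode (List.ofFn fun i => termCode (ts i)))
  | _, .imp φ ψ => Nat.pair 3 (Nat.pair (code φ) (code ψ))
  | _, .all φ => Nat.pair 4 (code φ)

theorem termCode_inj {n : ℕ} : Function.Injective (LtP.termCode (n := n)) := by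
  intro x
  induction x with
  | var x =>
    rcases x with x | x
    · exact x.elim
    intro y h
    rcases y with (y|y) | ⟨f, ts⟩
    · exact y.elim
    · simp_all [LtP.termCode, Nat.pair_eq_pair, Fin.ext_iff]
    · simp_all [LtP.termCode, Nat.pair_eq_pair]
  | func f ts ih =>
    intro y h
    rcases y with (y|y) | ⟨g, us⟩
    · exact y.elim
    · simp_all [LtP.termCode, Nat.pair_eq_pair]
    · simp only [LtP.termCode, Nat.pair_eq_pair, Encodable.encode_inj, true_and] at h
      obtain ⟨h1, h2⟩ := h
      cases f <;> cases g <;> simp_all [LtP.funcCode]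
      all_goals
        first
          | (congr 1; funext i; exact i.elim0)
          | (congr 1; funext i; fin_cases i
             · exact ih.1 rfl
             · exact ih.2 rfl)

theorem code_inj {n : ℕ} : Function.Injective (LtP.code (n := n)) := by
  intro x
  induction x with
  | falsum => intro y h; cases y <;> simp_all [LtP.code, Nat.pair_eq_pair]
  | equal a b =>
    intro y h; cases y <;> simp_all [LtP.code, Nat.pair_eq_pair]
    exact ⟨LtP.termCode_inj h.1, LtP.termCode_inj h.2⟩
  | rel R ts =>
    intro y h
    cases y with
    | rel S us =>
      cases R; cases S
      simp_all [LtP.code, Nat.pair_eq_pair]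
      congr 1; funext i; fin_cases i; exact LtP.termCode_inj h
    | _ => simp_all [LtP.code, Nat.pair_eq_pair]
  | imp a b i1 i2 =>
    intro y h; cases y <;> simp_all [LtP.code, Nat.pair_eq_pair]
    exact ⟨i1 rfl, i2 rfl⟩
  | all a i1 =>
    intro y h; cases y <;> simp_all [LtP.code, Nat.pair_eq_pair]
    exact i1 rfl

end LtP

/-! ## The three-sorted language `L_{val,×}` of valued fields with a cross-section -/

namespace Lval

/-- The sorts: field, value group (with `∞`), residue field. -/
inductive Srt : Type
  | K
  | Γ
  | k

/-- Terms of `L_{val,×}`, with variables `x_0, x_1, …` of each sort: the field and the residue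
field carry `{0, 1, +, ·}`, the value group `{0, +, ∞}` (and the relation `<`), and there are
function symbols `v : K → Γ`, `res : K → k` and `s : Γ → K`. -/
inductive Term : Srt → Type
  | var (σ : Srt) (i : ℕ) : Term σ
  | zeroK : Term .K
  | oneK : Term .K
  | addK : Term .K → Term .K → Term .K
  | mulK : Term .K → Term .K → Term .K
  | zeroΓ : Term .Γ
  | inftyΓ : Term .Γ
  | addΓ : Term .Γ → Term .Γ → Term .Γ
  | zerok : Term .k
  | onek : Term .k
  | addk : Term .k → Term .k → Term .k
  | mulk : Term .k → Term .k → Term .k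
  | v : Term .K → Term .Γ
  | res : Term .K → Term .k
  | s : Term .Γ → Term .K

/-- Formulas of `L_{val,×}`; the other connectives are abbreviations, e.g. `¬ φ` is `φ → ⊥`. -/
inductive Formula : Type
  | falsum : Formula
  | eq {σ : Srt} (t₁ t₂ : Term σ) : Formula
  | lt (t₁ t₂ : Term .Γ) : Formula
  | imp (φ ψ : Formula) : Formula
  | all (σ : Srt) (i : ℕ) (φ : Formula) : Formula
  | ex (σ : Srt) (i : ℕ) (φ : Formula) : Formula

/-- The variables occurring in a term. -/
def Term.vars : {σ : Srt} → Term σ → Set (Srt × ℕ)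
  | _, var σ i => {(σ, i)}
  | _, addK a b | _, mulK a b | _, addΓ a b | _, addk a b | _, mulk a b => a.vars ∪ b.vars
  | _, v a | _, res a | _, s a => a.vars
  | _, zeroK | _, oneK | _, zeroΓ | _, inftyΓ | _, zerok | _, onek => ∅

/-- The free variables of a formula. -/
def Formula.freeVars : Formula → Set (Srt × ℕ)
  | falsum => ∅
  | eq a b => a.vars ∪ b.vars
  | lt a b => a.vars ∪ b.vars
  | imp φ ψ => φ.freeVars ∪ ψ.freeVars
  | all σ i φ => φ.freeVars \ {(σ, i)}
  | ex σ i φ => φ.freeVars \ {(σ, i)}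

def Formula.IsSentence (φ : Formula) : Prop := φ.freeVars = ∅

/-- Quantifier-free formulas. -/
inductive Formula.IsQF : Formula → Prop
  | falsum : IsQF falsum
  | eq {σ : Srt} (a b : Term σ) : IsQF (eq a b)
  | lt (a b : Term .Γ) : IsQF (lt a b)
  | imp {φ ψ : Formula} : IsQF φ → IsQF ψ → IsQF (imp φ ψ)

/-- `∀`-formulas: a block of universal quantifiers followed by a quantifier-free formula. -/
inductive Formula.IsUniversal : Formula → Prop
  | of_isQF {φ : Formula} : IsQF φ → IsUniversal φ
  | all (σ : Srt) (i : ℕ) {φ : Formula} : IsUniversal φ → IsUniversal (all σ i φ)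

/-- `∃∀`-formulas: a block of existential quantifiers followed by a `∀`-formula. -/
inductive Formula.IsExistsForall : Formula → Prop
  | of_isUniversal {φ : Formula} : IsUniversal φ → IsExistsForall φ
  | ex (σ : Srt) (i : ℕ) {φ : Formula} : IsExistsForall φ → IsExistsForall (ex σ i φ)

/-- `L_{val,×}`-structures. -/
structure Str where
  carrier : Srt → Type
  zeroK : carrier .K
  oneK : carrier .K
  addK : carrier .K → carrier .K → carrier .K
  mulK : carrier .K → carrier .K → carrier .K
  zeroΓ : carrier .Γ
  inftyΓ : carrier .Γ
  addΓ : carrier .Γ → carrier .Γ → carrier .Γ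
  ltΓ : carrier .Γ → carrier .Γ → Prop
  zerok : carrier .k
  onek : carrier .k
  addk : carrier .k → carrier .k → carrier .k
  mulk : carrier .k → carrier .k → carrier .k
  v : carrier .K → carrier .Γ
  res : carrier .K → carrier .k
  s : carrier .Γ → carrier .K

/-- Assignments of values to the variables. -/
abbrev Str.Assignment (M : Str) : Type := (x : Srt × ℕ) → M.carrier x.1

def Term.eval (M : Str) (a : M.Assignment) : {σ : Srt} → Term σ → M.carrier σ
  | _, var σ i => a (σ, i)
  | _, zeroK => M.zeroK
  | _, oneK => M.oneK
  | _, addK x y => M.addK (x.eval M a) (y.eval M a)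
  | _, mulK x y => M.mulK (x.eval M a) (y.eval M a)
  | _, zeroΓ => M.zeroΓ
  | _, inftyΓ => M.inftyΓ
  | _, addΓ x y => M.addΓ (x.eval M a) (y.eval M a)
  | _, zerok => M.zerok
  | _, onek => M.onek
  | _, addk x y => M.addk (x.eval M a) (y.eval M a)
  | _, mulk x y => M.mulk (x.eval M a) (y.eval M a)
  | _, v x => M.v (x.eval M a)
  | _, res x => M.res (x.eval M a)
  | _, s x => M.s (x.eval M a)

open Classical in
/-- Tarski's satisfaction relation. -/
def Formula.Realize (M : Str) : Formula → M.Assignment → Prop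
  | falsum, _ => False
  | eq x y, a => x.eval M a = y.eval M a
  | lt x y, a => M.ltΓ (x.eval M a) (y.eval M a)
  | imp φ ψ, a => φ.Realize M a → ψ.Realize M a
  | all σ i φ, a => ∀ m : M.carrier σ, φ.Realize M (Function.update a (σ, i) m)
  | ex σ i φ, a => ∃ m : M.carrier σ, φ.Realize M (Function.update a (σ, i) m)

/-- Truth of a sentence in a structure (for a sentence and a structure with non-empty sorts, the
choice of the assignment does not matter). -/
def Str.Models (M : Str) (φ : Formula) : Prop := ∀ a : M.Assignment, φ.Realize M a

/-! Gödel numbering of `L_{val,×}`. -/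

def Srt.code : Srt → ℕ
  | K => 0
  | Γ => 1
  | k => 2

def Term.code : {σ : Srt} → Term σ → ℕ
  | _, var σ i => Nat.pair 0 (Nat.pair σ.code i)
  | _, zeroK => Nat.pair 1 0
  | _, oneK => Nat.pair 2 0
  | _, addK x y => Nat.pair 3 (Nat.pair x.code y.code)
  | _, mulK x y => Nat.pair 4 (Nat.pair x.code y.code)
  | _, zeroΓ => Nat.pair 5 0
  | _, inftyΓ => Nat.pair 6 0
  | _, addΓ x y => Nat.pair 7 (Nat.pair x.code y.code)
  | _, zerok => Nat.pair 8 0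
  | _, onek => Nat.pair 9 0
  | _, addk x y => Nat.pair 10 (Nat.pair x.code y.code)
  | _, mulk x y => Nat.pair 11 (Nat.pair x.code y.code)
  | _, v x => Nat.pair 12 x.code
  | _, res x => Nat.pair 13 x.code
  | _, s x => Nat.pair 14 x.code

def Formula.code : Formula → ℕ
  | falsum => Nat.pair 0 0
  | eq x y => Nat.pair 1 (Nat.pair x.code y.code)
  | lt x y => Nat.pair 2 (Nat.pair x.code y.code)
  | imp φ ψ => Nat.pair 3 (Nat.pair φ.code ψ.code)
  | all σ i φ => Nat.pair 4 (Nat.pair (Nat.pair σ.code i) φ.code)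
  | ex σ i φ => Nat.pair 5 (Nat.pair (Nat.pair σ.code i) φ.code)

theorem Term.code_inj : ∀ {σ : Lval.Srt} (x y : Lval.Term σ), x.code = y.code → x = y := by
  intro σ x
  induction x <;> intro y h <;> cases y <;> simp_all [Lval.Term.code, Nat.pair_eq_pair] <;>
    grind

theorem Term.code_sort : ∀ {σ τ : Lval.Srt} (x : Lval.Term σ) (y : Lval.Term τ), x.code = y.code → σ = τ := by
  intro σ τ x y h
  cases x <;> cases y <;> simp_all [Lval.Term.code, Nat.pair_eq_pair]
  rename_i i j
  cases σ <;> cases τ <;> simp_all [Lval.Srt.code]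

theorem Formula.code_inj : Function.Injective Lval.Formula.code := by
  intro x
  induction x <;> intro y h <;> cases y <;> simp_all [Lval.Formula.code, Nat.pair_eq_pair]
  case eq.eq a b σ c d =>
    obtain rfl := Lval.Term.code_sort _ _ h.1
    simp [Lval.Term.code_inj _ _ h.1, Lval.Term.code_inj _ _ h.2]
  case lt.lt => exact ⟨Lval.Term.code_inj _ _ h.1, Lval.Term.code_inj _ _ h.2⟩
  case imp.imp => grind
  case all.all σ _ _ _ τ _ _ => cases σ <;> cases τ <;> simp_all [Lval.Srt.code] <;> grind
  case ex.ex σ _ _ _ τ _ _ => cases σ <;> cases τ <;> simp_all [Lval.Srt.code] <;> grind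

end Lval

/-! ## Finite extensions of `ℚ_p` inside a fixed algebraic closure -/

namespace PadicExt

variable {p : ℕ} [Fact p.Prime]

/-- The additive valuation of a nonzero element of the algebraic closure of `ℚ_p`: the unique
extension of the `p`-adic valuation, with `ord p = 1`. -/
noncomputable def ord (x : PadicAlgCl p) : ℝ := -Real.logb p ‖x‖

/-- The value group `v(Kˣ)` of `K`. -/
noncomputable def valueGroup (K : IntermediateField ℚ_[p] (PadicAlgCl p)) : AddSubgroup ℝ where
  carrier := {r | ∃ x : K, x ≠ 0 ∧ ord (x : PadicAlgCl p) = r}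
  zero_mem' := ⟨1, one_ne_zero, by simp [ord]⟩
  add_mem' := by
    rintro _ _ ⟨x, hx, rfl⟩ ⟨y, hy, rfl⟩
    refine ⟨x * y, mul_ne_zero hx hy, ?_⟩
    have hx' : ‖(x : PadicAlgCl p)‖ ≠ 0 := by simpa using hx
    have hy' : ‖(y : PadicAlgCl p)‖ ≠ 0 := by simpa using hy
    simp only [ord, MulMemClass.coe_mul, norm_mul, Real.logb_mul hx' hy']
    ring
  neg_mem' := by
    rintro _ ⟨x, hx, rfl⟩
    exact ⟨x⁻¹, inv_ne_zero hx, by simp [ord, Real.logb_inv]⟩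

/-- The ramification index `e(K/ℚ_p) = (v(Kˣ) : v(ℚ_pˣ))`. -/
noncomputable def ramificationIndex (K : IntermediateField ℚ_[p] (PadicAlgCl p)) : ℕ :=
  (valueGroup (⊥ : IntermediateField ℚ_[p] (PadicAlgCl p))).relIndex (valueGroup K)

/-- `[K : ℚ_p] = e(K/ℚ_p) < ∞`. -/
def IsTotallyRamified (K : IntermediateField ℚ_[p] (PadicAlgCl p)) : Prop :=
  FiniteDimensional ℚ_[p] K ∧ Module.finrank ℚ_[p] K = ramificationIndex K

/-- The valuation ring `𝒪_K = {x ∈ K : ‖x‖ ≤ 1}`. -/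
noncomputable def integerRing (K : IntermediateField ℚ_[p] (PadicAlgCl p)) : ValuationSubring K :=
  ((PadicAlgCl.valued p).v.comap (algebraMap K (PadicAlgCl p))).valuationSubring

/-- The residue field of `𝒪_K`. -/
abbrev ResField (K : IntermediateField ℚ_[p] (PadicAlgCl p)) : Type :=
  IsLocalRing.ResidueField (integerRing K)

open Classical in
/-- The valuation `v : K → Γ ∪ {∞}`. -/
noncomputable def val (K : IntermediateField ℚ_[p] (PadicAlgCl p)) (x : K) :
    WithTop (valueGroup K) :=
  if h : x = 0 then ⊤ else ((⟨ord (x : PadicAlgCl p), x, h, rfl⟩ : valueGroup K) : WithTop _)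

open Classical in
/-- The residue map, extended by `0` outside `𝒪_K`. -/
noncomputable def resMap (K : IntermediateField ℚ_[p] (PadicAlgCl p)) (x : K) : ResField K :=
  if h : x ∈ integerRing K then IsLocalRing.residue (integerRing K) ⟨x, h⟩ else 0

/-- A cross-section of `K`: a group homomorphism `s : Γ → Kˣ` with `v ∘ s = id`. -/
structure CrossSection (K : IntermediateField ℚ_[p] (PadicAlgCl p)) where
  toHom : Multiplicative (valueGroup K) →* Kˣ
  val_toHom : ∀ γ : valueGroup K, val K (toHom (Multiplicative.ofAdd γ) : K) = γ

/-- The cross-section extended by `s(∞) = 0`. -/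
noncomputable def CrossSection.ext {K : IntermediateField ℚ_[p] (PadicAlgCl p)}
    (s : CrossSection K) : WithTop (valueGroup K) → K
  | ⊤ => 0
  | (γ : valueGroup K) => (s.toHom (Multiplicative.ofAdd γ) : K)

/-- `K` with its cross-section `s`, as an `L_{val,×}`-structure. -/
noncomputable def padicStr (K : IntermediateField ℚ_[p] (PadicAlgCl p)) (s : CrossSection K) :
    Lval.Str where
  carrier := fun
    | .K => K
    | .Γ => WithTop (valueGroup K)
    | .k => ResField K
  zeroK := (0 : K)
  oneK := (1 : K)
  addK := fun x y : K => x + y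
  mulK := fun x y : K => x * y
  zeroΓ := (0 : WithTop (valueGroup K))
  inftyΓ := (⊤ : WithTop (valueGroup K))
  addΓ := fun x y : WithTop (valueGroup K) => x + y
  ltΓ := fun x y : WithTop (valueGroup K) => x < y
  zerok := (0 : ResField K)
  onek := (1 : ResField K)
  addk := fun x y : ResField K => x + y
  mulk := fun x y : ResField K => x * y
  v := val K
  res := resMap K
  s := s.ext

/-- The totally ramified finite extensions of `ℚ_p`. -/
abbrev TotRam (p : ℕ) [Fact p.Prime] : Type :=
  {K : IntermediateField ℚ_[p] (PadicAlgCl p) // IsTotallyRamified K}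

/-- The asymptotic `∃∀`-theory of the totally ramified finite extensions `K` of `ℚ_p`, each
equipped with the cross-section `s K`: the `∃∀`-sentences that are true in all but finitely
many of them. -/
def asymptoticExistsForallTheory (s : (K : TotRam p) → CrossSection K.1) : Set Lval.Formula :=
  {φ | φ.IsSentence ∧ φ.IsExistsForall ∧
    ∀ᶠ K : TotRam p in Filter.cofinite, (padicStr K.1 (s K)).Models φ}

end PadicExt

/-- The characteristic function of a set of natural numbers, as an oracle. -/
noncomputable def charFun (A : Set ℕ) : ℕ →. ℕ := ((A.indicator 1 : ℕ → ℕ) : ℕ →. ℕ)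

/-! Let `K` be totally ramified of degree `n` with cross-section `s`, let `γ` be the least positive
element of its value group, and put `π = s γ`. Then `π` is a uniformizer, `𝒪_K = ℤ_p[π]`, and since
`p` and `π ^ n` have the same norm, sending `π` to `t` identifies `𝒪_K / p` with `𝔽_p[t]/(t^n)`. So
this ring can be interpreted in `K`, uniformly in `K` and `s`: elements become integral field
elements, equality becomes `v(a - b) ≥ v(p)`, and `t` becomes `s(γ)`. The predicate `P(τ)` becomes
`τ ≡ s(v(τ))` modulo `p`, because `s` takes nonnegative values to powers of `π` (`mem_powers_iff`).
The one universal quantifier says that `γ` is least positive, so existential sentences become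
`∃∀`-sentences; an auxiliary variable with value `-1` makes up for the missing subtraction. The
outcome is `models_closure_iff`: `K` satisfies the translation iff `𝔽_p[t]/(t^n)` satisfies the
original sentence, for `n = [K : ℚ_p]`.

It remains to match the two meanings of "all but finitely many". Each `n ≥ 1` is the degree of some
totally ramified extension (a root of `X ^ n - p`), and of only finitely many: each is generated by
a root of an Eisenstein polynomial, these polynomials form a compact set, and by Krasner's lemma the
degree-`n` fields generated by integral roots of polynomials near a given one are finite in number.
Hence degree is finite-to-one, and its image omits only `0`.

Finally, the translation acts on Gödel numbers as a primitive recursive function that sends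
everything else to the code of `⊥`. This is a many-one reduction, hence a Turing reduction. -/

namespace PadicExt

/-! ### Value groups of finite extensions of `ℚ_p` and total ramification. -/

open Polynomial IntermediateField

variable {p : ℕ} [Fact p.Prime]

theorem norm_pow_natDegree_minpoly (x : PadicAlgCl p) :
    ‖x‖ ^ (minpoly ℚ_[p] x).natDegree = ‖(minpoly ℚ_[p] x).coeff 0‖ := by
  have h := spectralNorm.spectralNorm_eq_norm_coeff_zero_rpow ℚ_[p] (PadicAlgCl p) x
  have hd : (minpoly ℚ_[p] x).natDegree ≠ 0 :=
    (minpoly.natDegree_pos (Algebra.IsIntegral.isIntegral x)).ne'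
  rw [PadicAlgCl.spectralNorm_eq] at h
  rw [h, one_div, Real.rpow_inv_natCast_pow (norm_nonneg _) hd]

theorem one_lt_cast_prime : (1 : ℝ) < p := by exact_mod_cast (Fact.out : p.Prime).one_lt

theorem ord_mul {x y : PadicAlgCl p} (hx : x ≠ 0) (hy : y ≠ 0) : ord (x * y) = ord x + ord y := by
  simp only [ord, norm_mul, Real.logb_mul (norm_ne_zero_iff.2 hx) (norm_ne_zero_iff.2 hy)]
  ring

theorem ord_pow (x : PadicAlgCl p) (k : ℕ) : ord (x ^ k) = k * ord x := by
  simp [ord, norm_pow, Real.logb_pow]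

theorem norm_eq_rpow_neg_ord {x : PadicAlgCl p} (hx : x ≠ 0) : ‖x‖ = (p : ℝ) ^ (-ord x) := by
  have h1 := one_lt_cast_prime (p := p)
  rw [ord, neg_neg, Real.rpow_logb (by linarith) h1.ne' (norm_pos_iff.2 hx)]

theorem ord_eq_of_norm_eq_rpow {x : PadicAlgCl p} {r : ℝ} (h : ‖x‖ = (p : ℝ) ^ (-r)) :
    ord x = r := by
  have h1 := one_lt_cast_prime (p := p)
  rw [ord, h, Real.logb_rpow (by linarith) h1.ne', neg_neg]

theorem norm_le_norm_iff_ord_le {x y : PadicAlgCl p} (hx : x ≠ 0) (hy : y ≠ 0) :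
    ‖x‖ ≤ ‖y‖ ↔ ord y ≤ ord x := by
  rw [ord, ord, neg_le_neg_iff,
    Real.logb_le_logb one_lt_cast_prime (norm_pos_iff.2 hx) (norm_pos_iff.2 hy)]

theorem ord_algebraMap {a : ℚ_[p]} (ha : a ≠ 0) :
    ord (algebraMap ℚ_[p] (PadicAlgCl p) a) = a.valuation := by
  apply ord_eq_of_norm_eq_rpow
  rw [PadicAlgCl.norm_extends, Padic.norm_eq_zpow_neg_valuation ha, ← Real.rpow_intCast]
  simp

/-- The norm of `x` is the `d`-th root of the norm of the constant coefficient of its minimal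
polynomial, where `d` is the degree of that polynomial; so `d * ord x` is an integer, and `d`
divides `[K : ℚ_p]`. -/
theorem exists_int_finrank_mul_ord (K : IntermediateField ℚ_[p] (PadicAlgCl p))
    [FiniteDimensional ℚ_[p] K] {x : PadicAlgCl p} (hxK : x ∈ K) (hx : x ≠ 0) :
    ∃ z : ℤ, Module.finrank ℚ_[p] K * ord x = z := by
  have hxint : IsIntegral ℚ_[p] x := Algebra.IsIntegral.isIntegral x
  have h0 : (minpoly ℚ_[p] x).coeff 0 ≠ 0 := by
    intro h
    exact hx ((minpoly.coeff_zero_eq_zero hxint).1 h)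
  have hd : (minpoly ℚ_[p] x).natDegree * ord x = ((minpoly ℚ_[p] x).coeff 0).valuation := by
    rw [← ord_pow, ← ord_algebraMap h0, ord, ord, norm_pow, norm_pow_natDegree_minpoly,
      PadicAlgCl.norm_extends]
  have hdvd : (minpoly ℚ_[p] x).natDegree ∣ Module.finrank ℚ_[p] K := by
    have := minpoly.degree_dvd (K := ℚ_[p]) (L := K) (x := ⟨x, hxK⟩)
      (Algebra.IsIntegral.isIntegral _)
    rwa [IntermediateField.minpoly_eq] at this
  obtain ⟨e, he⟩ := hdvd
  refine ⟨e * ((minpoly ℚ_[p] x).coeff 0).valuation, ?_⟩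
  push_cast
  rw [he, ← hd]
  push_cast
  ring

theorem valueGroup_bot :
    valueGroup (⊥ : IntermediateField ℚ_[p] (PadicAlgCl p)) = AddSubgroup.zmultiples (1 : ℝ) := by
  ext r
  constructor
  · rintro ⟨⟨x, hx⟩, hx0, rfl⟩
    obtain ⟨a, rfl⟩ := IntermediateField.mem_bot.1 hx
    have ha : a ≠ 0 := by rintro rfl; exact hx0 (Subtype.ext (by simp))
    exact ⟨a.valuation, by simp [ord_algebraMap ha]⟩
  · rintro ⟨z, rfl⟩
    have hp : ((p : ℚ_[p]) ^ z) ≠ 0 :=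
      zpow_ne_zero _ (by exact_mod_cast (Fact.out : p.Prime).ne_zero)
    refine ⟨⟨algebraMap _ _ ((p : ℚ_[p]) ^ z), IntermediateField.algebraMap_mem _ _⟩, ?_, ?_⟩
    · intro h
      have := congrArg Subtype.val h
      exact hp ((map_eq_zero (algebraMap ℚ_[p] (PadicAlgCl p))).1 this)
    · show ord (algebraMap ℚ_[p] (PadicAlgCl p) ((p : ℚ_[p]) ^ z)) = _
      rw [ord_algebraMap hp]; simp

theorem relIndex_zmultiples_one {n : ℕ} (hn : n ≠ 0) :
    (AddSubgroup.zmultiples (1 : ℝ)).relIndex (AddSubgroup.zmultiples ((n : ℝ)⁻¹)) = n := by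
  have hn' : (n : ℝ) ≠ 0 := by exact_mod_cast hn
  let f : ℤ →+ ℝ := zmultiplesHom ℝ ((n : ℝ)⁻¹)
  have hf : Function.Injective f := by
    intro a b h
    simpa [f, hn'] using h
  have h1 : AddSubgroup.zmultiples (1 : ℝ) = (AddSubgroup.zmultiples (n : ℤ)).map f := by
    rw [AddMonoidHom.map_zmultiples]; simp [f, hn']
  have h2 : AddSubgroup.zmultiples ((n : ℝ)⁻¹) = (⊤ : AddSubgroup ℤ).map f := by
    rw [← Int.zmultiples_one, AddMonoidHom.map_zmultiples]; simp [f]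
  rw [h1, h2, AddSubgroup.relIndex_map_map_of_injective _ _ hf, AddSubgroup.relIndex_top_right,
    Int.index_zmultiples]
  simp

theorem valueGroup_le (K : IntermediateField ℚ_[p] (PadicAlgCl p)) [FiniteDimensional ℚ_[p] K] :
    valueGroup K ≤ AddSubgroup.zmultiples ((Module.finrank ℚ_[p] K : ℝ)⁻¹) := by
  rintro r ⟨x, hx, rfl⟩
  obtain ⟨z, hz⟩ := exists_int_finrank_mul_ord K x.2 (by simpa using hx)
  have hn : (Module.finrank ℚ_[p] K : ℝ) ≠ 0 := by exact_mod_cast Module.finrank_pos.ne'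
  refine ⟨z, ?_⟩
  simp only [zsmul_eq_mul, ← hz]
  field_simp

/-- In the chain `ℤ ≤ v(Kˣ) ≤ (1/n)ℤ` the total index is `n`, and total ramification says that the
lower index is already `n`, so the upper one is `1`. -/
theorem IsTotallyRamified.valueGroup_eq {K : IntermediateField ℚ_[p] (PadicAlgCl p)}
    (hK : IsTotallyRamified K) :
    valueGroup K = AddSubgroup.zmultiples ((Module.finrank ℚ_[p] K : ℝ)⁻¹) := by
  have := hK.1
  have hn : Module.finrank ℚ_[p] K ≠ 0 := Module.finrank_pos.ne'
  refine le_antisymm (valueGroup_le K) (AddSubgroup.relIndex_eq_one.1 ?_)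
  have hbot : valueGroup (⊥ : IntermediateField ℚ_[p] (PadicAlgCl p)) ≤ valueGroup K := by
    rintro r ⟨x, hx, rfl⟩
    refine ⟨⟨x, (bot_le : ⊥ ≤ K) x.2⟩, fun h => hx (Subtype.ext ?_), rfl⟩
    exact (congrArg Subtype.val h : (x : PadicAlgCl p) = 0)
  have h := AddSubgroup.relIndex_mul_relIndex _ _ _ hbot (valueGroup_le K)
  have h2 : (valueGroup (⊥ : IntermediateField ℚ_[p] (PadicAlgCl p))).relIndex (valueGroup K)
    = Module.finrank ℚ_[p] K := hK.2.symm
  rw [h2, valueGroup_bot, relIndex_zmultiples_one hn] at h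
  exact Nat.eq_of_mul_eq_mul_left (Nat.pos_of_ne_zero hn) (by rw [h, mul_one])

theorem isTotallyRamified_of_ord_eq {K : IntermediateField ℚ_[p] (PadicAlgCl p)}
    [FiniteDimensional ℚ_[p] K] {x : PadicAlgCl p} (hxK : x ∈ K) (hx : x ≠ 0)
    (h : ord x = (Module.finrank ℚ_[p] K : ℝ)⁻¹) : IsTotallyRamified K := by
  refine ⟨inferInstance, ?_⟩
  have hn : Module.finrank ℚ_[p] K ≠ 0 := Module.finrank_pos.ne'
  have : valueGroup K = AddSubgroup.zmultiples ((Module.finrank ℚ_[p] K : ℝ)⁻¹) := by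
    refine le_antisymm (valueGroup_le K) ?_
    rw [AddSubgroup.zmultiples_le]
    exact ⟨⟨x, hxK⟩, fun h => hx (congrArg Subtype.val h), h⟩
  rw [ramificationIndex, this, valueGroup_bot, relIndex_zmultiples_one hn]

/-- Eisenstein's criterion at `p`, with divisibility phrased by norms: a constant coefficient of
norm `p⁻¹` is not divisible by `p ^ 2`. Gauss's lemma passes from `ℤ_p` to `ℚ_p`. -/
theorem irreducible_map_of_eisenstein {f : ℤ_[p][X]} (hf : f.Monic) (hd : 0 < f.natDegree)
    (hlt : ∀ i < f.natDegree, ‖f.coeff i‖ < 1) (h0 : ‖f.coeff 0‖ = (p : ℝ)⁻¹) :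
    Irreducible (f.map (algebraMap ℤ_[p] ℚ_[p])) := by
  rw [← hf.irreducible_iff_irreducible_map_fraction_map]
  have hprime : (Ideal.span {(p : ℤ_[p])}).IsPrime := by
    rw [← PadicInt.maximalIdeal_eq_span_p]; infer_instance
  have hE : f.IsEisensteinAt (Ideal.span {(p : ℤ_[p])}) := by
    refine ⟨?_, fun {i} hi => ?_, ?_⟩
    · rw [hf.leadingCoeff]
      exact fun h => hprime.ne_top ((Ideal.eq_top_iff_one _).2 h)
    · rw [Ideal.mem_span_singleton, ← PadicInt.norm_lt_one_iff_dvd]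
      exact hlt i hi
    · rw [Ideal.span_singleton_pow, ← PadicInt.norm_le_pow_iff_mem_span_pow, h0, not_le]
      have h1 := one_lt_cast_prime (p := p)
      rw [show (p : ℝ) ^ (-((2 : ℕ) : ℤ)) = (p : ℝ)⁻¹ * (p : ℝ)⁻¹ by
        rw [zpow_neg, ← mul_inv]; norm_cast; rw [sq] ]
      have h2 : (p : ℝ)⁻¹ < 1 := inv_lt_one_of_one_lt₀ h1
      have h3 : 0 < (p : ℝ)⁻¹ := by positivity
      nlinarith
  exact hE.irreducible hprime hf.isPrimitive hd

/-- Adjoin a root of the Eisenstein polynomial `X ^ n - p`; its order is `1/n`. -/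
theorem exists_totRam_finrank_eq {n : ℕ} (hn : n ≠ 0) :
    ∃ K : TotRam p, Module.finrank ℚ_[p] K.1 = n := by
  have hpp : (p : ℚ_[p]) ≠ 0 := by exact_mod_cast (Fact.out : p.Prime).ne_zero
  let f : ℤ_[p][X] := X ^ n - C (p : ℤ_[p])
  have hf : f.Monic := monic_X_pow_sub_C _ hn
  have hdeg : f.natDegree = n := natDegree_X_pow_sub_C
  have hirr : Irreducible (f.map (algebraMap ℤ_[p] ℚ_[p])) := by
    have h1 : (p : ℝ)⁻¹ < 1 := inv_lt_one_of_one_lt₀ one_lt_cast_prime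
    refine irreducible_map_of_eisenstein hf (by omega) (fun i hi => ?_) ?_
    · rw [hdeg] at hi
      rcases i with _ | i
      · simpa [f, coeff_X_pow, hn.symm] using h1
      · simp [f, coeff_X_pow, hi.ne]
    · simp [f, coeff_X_pow, hn.symm]
  have hg : f.map (algebraMap ℤ_[p] ℚ_[p]) = X ^ n - C (p : ℚ_[p]) := by simp [f]
  rw [hg] at hirr
  have hgm : (X ^ n - C (p : ℚ_[p])).Monic := monic_X_pow_sub_C _ hn
  obtain ⟨β, hβ⟩ := IsAlgClosed.exists_aeval_eq_zero (PadicAlgCl p) (X ^ n - C (p : ℚ_[p]))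
    hirr.degree_pos.ne'
  have hmin : minpoly ℚ_[p] β = X ^ n - C (p : ℚ_[p]) :=
    (minpoly.eq_of_irreducible_of_monic hirr hβ hgm).symm
  have hxint : IsIntegral ℚ_[p] β := Algebra.IsIntegral.isIntegral β
  have : FiniteDimensional ℚ_[p] ℚ_[p]⟮β⟯ := IntermediateField.adjoin.finiteDimensional hxint
  have hfin : Module.finrank ℚ_[p] ℚ_[p]⟮β⟯ = n := by
    rw [IntermediateField.adjoin.finrank hxint, hmin, natDegree_X_pow_sub_C]
  have hpow : β ^ n = algebraMap ℚ_[p] (PadicAlgCl p) p := by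
    have : β ^ n - algebraMap ℚ_[p] (PadicAlgCl p) p = 0 := by simpa using hβ
    exact sub_eq_zero.1 this
  have hβ0 : β ≠ 0 := by
    rintro rfl
    rw [zero_pow hn] at hpow
    exact hpp ((map_eq_zero _).1 hpow.symm)
  have hord : ord β = (n : ℝ)⁻¹ := by
    have h := congrArg ord hpow
    rw [ord_pow, ord_algebraMap hpp] at h
    have hn' : (n : ℝ) ≠ 0 := by exact_mod_cast hn
    field_simp
    simpa [mul_comm] using h
  exact ⟨⟨ℚ_[p]⟮β⟯, isTotallyRamified_of_ord_eq (mem_adjoin_simple_self _ β) hβ0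
    (by rw [hord, hfin])⟩, hfin⟩

end PadicExt

/-! ### Reduction modulo `p`: the isomorphism between `𝒪_K / p` and `𝔽_p[t]/(t^n)`. -/

namespace PadicExt

open Polynomial IntermediateField

variable {p : ℕ} [Fact p.Prime]

theorem norm_sum_le_of_forall_le {ι : Type*} {s : Finset ι} {f : ι → PadicAlgCl p} {C : ℝ}
    (hC : 0 ≤ C) (h : ∀ i ∈ s, ‖f i‖ ≤ C) : ‖∑ i ∈ s, f i‖ ≤ C :=
  IsUltrametricDist.norm_sum_le_of_forall_le_of_nonneg hC h

theorem norm_sum_eq_of_lt {ι : Type*} {s : Finset ι} {f : ι → PadicAlgCl p} {k : ι} (hk : k ∈ s)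
    (h : ∀ i ∈ s, i ≠ k → ‖f i‖ < ‖f k‖) : ‖∑ i ∈ s, f i‖ = ‖f k‖ :=
  (PadicAlgCl.isNonarchimedean p).apply_sum_eq_of_lt (fun a => (norm_neg a).symm) hk h

theorem norm_algebraMap_padicInt (c : ℤ_[p]) : ‖algebraMap ℤ_[p] (PadicAlgCl p) c‖ = ‖c‖ := by
  rw [IsScalarTower.algebraMap_apply ℤ_[p] ℚ_[p] (PadicAlgCl p), PadicAlgCl.norm_extends]
  rfl

theorem toZMod_eq_zero_iff (c : ℤ_[p]) : PadicInt.toZMod c = 0 ↔ ‖c‖ ≤ (p : ℝ)⁻¹ := by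
  rw [← RingHom.mem_ker, PadicInt.ker_toZMod, PadicInt.maximalIdeal_eq_span_p]
  have := PadicInt.norm_le_pow_iff_mem_span_pow c 1
  simpa using this.symm

theorem norm_eq_one_of_toZMod_ne_zero {c : ℤ_[p]} (h : PadicInt.toZMod c ≠ 0) : ‖c‖ = 1 := by
  rw [← PadicInt.isUnit_iff]
  by_contra hc
  exact h (by rwa [← RingHom.mem_ker, PadicInt.ker_toZMod])

section Uniformizer

variable {n : ℕ} {π : PadicAlgCl p}

theorem norm_uniformizer_pos (hn : n ≠ 0) (hπ : ‖π‖ ^ n = (p : ℝ)⁻¹) : 0 < ‖π‖ := by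
  have h1 := one_lt_cast_prime (p := p)
  refine lt_of_le_of_ne (norm_nonneg _) fun h => ?_
  rw [← h, zero_pow hn] at hπ
  have : (0 : ℝ) < (p : ℝ)⁻¹ := by positivity
  linarith

theorem norm_uniformizer_lt_one (hn : n ≠ 0) (hπ : ‖π‖ ^ n = (p : ℝ)⁻¹) : ‖π‖ < 1 := by
  rw [← pow_lt_one_iff_of_nonneg (norm_nonneg _) hn, hπ]
  exact inv_lt_one_of_one_lt₀ one_lt_cast_prime

theorem norm_uniformizer_pow_lt (hn : n ≠ 0) (hπ : ‖π‖ ^ n = (p : ℝ)⁻¹) {i j : ℕ} (h : i < j) :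
    ‖π‖ ^ j < ‖π‖ ^ i :=
  pow_lt_pow_right_of_lt_one₀ (norm_uniformizer_pos hn hπ) (norm_uniformizer_lt_one hn hπ) h

theorem norm_aeval_le_one (hn : n ≠ 0) (hπ : ‖π‖ ^ n = (p : ℝ)⁻¹) (g : ℤ_[p][X]) :
    ‖aeval π g‖ ≤ 1 := by
  rw [aeval_eq_sum_range]
  refine norm_sum_le_of_forall_le zero_le_one fun i _ => ?_
  rw [Algebra.smul_def, norm_mul, norm_algebraMap_padicInt, norm_pow]
  exact mul_le_one₀ (PadicInt.norm_le_one _) (by positivity)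
    (pow_le_one₀ (norm_nonneg _) (norm_uniformizer_lt_one hn hπ).le)

/-- If `k < n` is the first index at which the reduction of `g` is nonzero, the term of degree `k`
strictly dominates: earlier terms have norm at most `p⁻¹ = ‖π‖ ^ n`, later ones at most `‖π‖ ^ (k +
1)`. So `‖g(π)‖ = ‖π‖ ^ k > p⁻¹`. If there is no such index, every term has norm at most `p⁻¹`. -/
theorem norm_aeval_le_iff (hn : n ≠ 0) (hπ : ‖π‖ ^ n = (p : ℝ)⁻¹) (g : ℤ_[p][X]) :
    ‖aeval π g‖ ≤ (p : ℝ)⁻¹ ↔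
      (Ideal.Quotient.mk _ (g.map PadicInt.toZMod) : TruncPoly p n) = 0 := by
  have hterm : ∀ i, ‖g.coeff i • π ^ i‖ = ‖g.coeff i‖ * ‖π‖ ^ i := fun i => by
    rw [Algebra.smul_def, norm_mul, norm_algebraMap_padicInt, norm_pow]
  have hpow : ∀ i, ‖π‖ ^ i ≤ 1 := fun i =>
    pow_le_one₀ (norm_nonneg _) (norm_uniformizer_lt_one hn hπ).le
  rw [Ideal.Quotient.eq_zero_iff_mem, Ideal.mem_span_singleton, X_pow_dvd_iff,
    aeval_eq_sum_range]
  simp only [coeff_map]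
  constructor
  · intro h
    by_contra! hne
    classical
    obtain ⟨k, ⟨hkn, hk0⟩, hmin⟩ : ∃ k, (k < n ∧ PadicInt.toZMod (g.coeff k) ≠ 0) ∧
        ∀ j < k, PadicInt.toZMod (g.coeff j) = 0 := by
      refine ⟨Nat.find hne, Nat.find_spec hne, fun j hj => ?_⟩
      have := Nat.find_min hne hj
      push Not at this
      exact this (hj.trans (Nat.find_spec hne).1)
    have hunit := norm_eq_one_of_toZMod_ne_zero hk0
    have hksup : k ∈ Finset.range (g.natDegree + 1) := by
      rw [Finset.mem_range, Nat.lt_succ_iff]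
      apply le_natDegree_of_ne_zero
      intro h0
      exact hk0 (by rw [h0, map_zero])
    rw [norm_sum_eq_of_lt hksup, hterm] at h
    · rw [hunit, one_mul, ← hπ] at h
      exact absurd (norm_uniformizer_pow_lt hn hπ hkn) (not_lt.2 h)
    · intro i _ hik
      rw [hterm, hterm, hunit, one_mul]
      rcases lt_or_gt_of_ne hik with hlt | hgt
      · calc ‖g.coeff i‖ * ‖π‖ ^ i ≤ (p : ℝ)⁻¹ * 1 :=
              mul_le_mul ((toZMod_eq_zero_iff _).1 (hmin i hlt)) (hpow i) (by positivity)
                (by positivity)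
          _ = ‖π‖ ^ n := by rw [mul_one, hπ]
          _ < ‖π‖ ^ k := norm_uniformizer_pow_lt hn hπ hkn
      · calc ‖g.coeff i‖ * ‖π‖ ^ i ≤ 1 * ‖π‖ ^ i := by
              gcongr; exact PadicInt.norm_le_one _
          _ < ‖π‖ ^ k := by rw [one_mul]; exact norm_uniformizer_pow_lt hn hπ hgt
  · intro h
    refine norm_sum_le_of_forall_le (by positivity) fun i _ => ?_
    rw [hterm]
    rcases lt_or_ge i n with hi | hi
    · calc ‖g.coeff i‖ * ‖π‖ ^ i ≤ (p : ℝ)⁻¹ * 1 :=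
              mul_le_mul ((toZMod_eq_zero_iff _).1 (h i hi)) (hpow i) (by positivity)
                (by positivity)
          _ = _ := mul_one _
    · calc ‖g.coeff i‖ * ‖π‖ ^ i ≤ 1 * ‖π‖ ^ n := by
              refine mul_le_mul (PadicInt.norm_le_one _) ?_ (by positivity) zero_le_one
              exact pow_le_pow_of_le_one (norm_nonneg _) (norm_uniformizer_lt_one hn hπ).le hi
          _ = _ := by rw [one_mul, hπ]

/-- `y` is the reduction modulo `p` of `x ∈ ℤ_p[π]`, where `π` reduces to `t`. -/
def Reduces (π x : PadicAlgCl p) (y : TruncPoly p n) : Prop :=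
  ∃ g : ℤ_[p][X], aeval π g = x ∧ Ideal.Quotient.mk _ (g.map PadicInt.toZMod) = y

namespace Reduces

variable {x x' : PadicAlgCl p} {y y' : TruncPoly p n}

theorem zero : Reduces π 0 (0 : TruncPoly p n) := ⟨0, by simp⟩

theorem one : Reduces π 1 (1 : TruncPoly p n) := ⟨1, by simp⟩

theorem uniformizer : Reduces π π (TruncPoly.t p n) := ⟨X, by simp [TruncPoly.t]⟩

theorem add (h : Reduces π x y) (h' : Reduces π x' y') : Reduces π (x + x') (y + y') := by
  obtain ⟨g, rfl, rfl⟩ := h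
  obtain ⟨g', rfl, rfl⟩ := h'
  exact ⟨g + g', by simp⟩

theorem mul (h : Reduces π x y) (h' : Reduces π x' y') : Reduces π (x * x') (y * y') := by
  obtain ⟨g, rfl, rfl⟩ := h
  obtain ⟨g', rfl, rfl⟩ := h'
  exact ⟨g * g', by simp⟩

theorem uniformizer_pow (k : ℕ) : Reduces π (π ^ k) (TruncPoly.t p n ^ k) :=
  ⟨X ^ k, by simp [TruncPoly.t]⟩

theorem norm_le_one (hn : n ≠ 0) (hπ : ‖π‖ ^ n = (p : ℝ)⁻¹) (h : Reduces π x y) : ‖x‖ ≤ 1 := by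
  obtain ⟨g, rfl, -⟩ := h
  exact norm_aeval_le_one hn hπ g

/-- Read from right to left and from left to right, this makes the relation `Reduces` a well-defined
injection from `ℤ_p[π]` modulo `p`; it is what translates equality. -/
theorem norm_sub_le_iff (hn : n ≠ 0) (hπ : ‖π‖ ^ n = (p : ℝ)⁻¹) (h : Reduces π x y)
    (h' : Reduces π x' y') : ‖x - x'‖ ≤ (p : ℝ)⁻¹ ↔ y = y' := by
  obtain ⟨g, rfl, rfl⟩ := h
  obtain ⟨g', rfl, rfl⟩ := h'
  rw [← map_sub, norm_aeval_le_iff hn hπ, Polynomial.map_sub, map_sub, sub_eq_zero]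

end Reduces

theorem exists_reduces_left (π : PadicAlgCl p) (y : TruncPoly p n) :
    ∃ g : ℤ_[p][X], Reduces π (aeval π g) y := by
  obtain ⟨f, rfl⟩ := Ideal.Quotient.mk_surjective y
  obtain ⟨g, rfl⟩ := Polynomial.map_surjective PadicInt.toZMod
    (ZMod.ringHom_surjective PadicInt.toZMod) f
  exact ⟨g, g, rfl, rfl⟩

end Uniformizer

theorem TruncPoly_t_pow_eq_zero {n k : ℕ} (h : n ≤ k) : TruncPoly.t p n ^ k = 0 := by
  rw [TruncPoly.t, ← map_pow, Ideal.Quotient.eq_zero_iff_mem, Ideal.mem_span_singleton]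
  exact pow_dvd_pow _ h

theorem ord_uniformizer {n : ℕ} {π : PadicAlgCl p} (hπ : ‖π‖ ^ n = (p : ℝ)⁻¹) :
    n * ord π = 1 := by
  rw [← ord_pow]
  apply ord_eq_of_norm_eq_rpow
  rw [norm_pow, hπ, Real.rpow_neg_one]

section Field

variable {K : IntermediateField ℚ_[p] (PadicAlgCl p)} [FiniteDimensional ℚ_[p] K]
  {π : PadicAlgCl p}

/-- With `d` the degree of the minimal polynomial, `d * ord π = d / n` must be an integer, so `n ∣
d`, while `d ∣ n` holds for any element of `K`. -/
theorem natDegree_minpoly_uniformizer (hK : π ∈ K)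
    (hπ : ‖π‖ ^ Module.finrank ℚ_[p] K = (p : ℝ)⁻¹) :
    (minpoly ℚ_[p] π).natDegree = Module.finrank ℚ_[p] K := by
  have hn : Module.finrank ℚ_[p] K ≠ 0 := Module.finrank_pos.ne'
  have h0 : π ≠ 0 := norm_pos_iff.1 (norm_uniformizer_pos hn hπ)
  have hxint : IsIntegral ℚ_[p] π := Algebra.IsIntegral.isIntegral π
  have : FiniteDimensional ℚ_[p] ℚ_[p]⟮π⟯ := IntermediateField.adjoin.finiteDimensional hxint
  obtain ⟨z, hz⟩ := exists_int_finrank_mul_ord ℚ_[p]⟮π⟯ (mem_adjoin_simple_self _ π) h0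
  rw [IntermediateField.adjoin.finrank hxint] at hz
  have h1 := ord_uniformizer hπ
  have hdvd : (minpoly ℚ_[p] π).natDegree ∣ Module.finrank ℚ_[p] K := by
    have := minpoly.degree_dvd (K := ℚ_[p]) (L := K) (x := ⟨π, hK⟩)
      (Algebra.IsIntegral.isIntegral _)
    rwa [IntermediateField.minpoly_eq] at this
  refine Nat.dvd_antisymm hdvd ?_
  have h2 : ((minpoly ℚ_[p] π).natDegree : ℝ) = Module.finrank ℚ_[p] K * z := by
    rw [← hz]; linear_combination -((minpoly ℚ_[p] π).natDegree : ℝ) * h1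
  have h3 : ((minpoly ℚ_[p] π).natDegree : ℤ) = Module.finrank ℚ_[p] K * z := by
    exact_mod_cast h2
  exact Int.natCast_dvd_natCast.1 ⟨z, h3⟩

theorem adjoin_uniformizer (hK : π ∈ K) (hπ : ‖π‖ ^ Module.finrank ℚ_[p] K = (p : ℝ)⁻¹) :
    ℚ_[p]⟮π⟯ = K := by
  have hxint : IsIntegral ℚ_[p] π := Algebra.IsIntegral.isIntegral π
  refine IntermediateField.eq_of_le_of_finrank_eq (adjoin_simple_le_iff.2 hK) ?_
  rw [IntermediateField.adjoin.finrank hxint, natDegree_minpoly_uniformizer hK hπ]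

/-- This is `𝒪_K = ℤ_p[π]`. Write `x = ∑ g_i π ^ i` with `i < n` and `g_i ∈ ℚ_p`. The orders of the
nonzero terms lie in the distinct classes `i/n` modulo `ℤ`, so there is no cancellation and every
term is integral. Then `v(g_i) + i/n ≥ 0` with `i < n` forces the integer `v(g_i)` to be
nonnegative. -/
theorem exists_reduces_right (hK : π ∈ K)
    (hπ : ‖π‖ ^ Module.finrank ℚ_[p] K = (p : ℝ)⁻¹) {x : PadicAlgCl p} (hx : x ∈ K)
    (hx1 : ‖x‖ ≤ 1) : ∃ y : TruncPoly p (Module.finrank ℚ_[p] K), Reduces π x y := by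
  set n := Module.finrank ℚ_[p] K with hn_def
  have hn : n ≠ 0 := Module.finrank_pos.ne'
  have hπ0 : π ≠ 0 := norm_pos_iff.1 (norm_uniformizer_pos hn hπ)
  have hxint : IsIntegral ℚ_[p] π := Algebra.IsIntegral.isIntegral π
  have hord := ord_uniformizer hπ
  obtain ⟨g, hdeg, rfl⟩ : ∃ g : ℚ_[p][X], g.natDegree < n ∧ aeval π g = x := by
    rw [← adjoin_uniformizer hK hπ] at hx
    rw [← IntermediateField.mem_toSubalgebra, adjoin_simple_toSubalgebra_of_isAlgebraic
      hxint.isAlgebraic, Algebra.adjoin_singleton_eq_range_aeval] at hx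
    obtain ⟨f, rfl⟩ := hx
    refine ⟨f %ₘ minpoly ℚ_[p] π, ?_, ?_⟩
    · rw [hn_def, ← natDegree_minpoly_uniformizer hK hπ]
      exact natDegree_modByMonic_lt _ (minpoly.monic hxint) (minpoly.ne_one _ _)
    · rw [modByMonic_eq_sub_mul_div]
      simp
  suffices h : ∀ i ∈ Finset.range n, ‖g.coeff i‖ ≤ 1 by
    let c : ℕ → ℤ_[p] := fun i => if hi : ‖g.coeff i‖ ≤ 1 then ⟨g.coeff i, hi⟩ else 0
    refine ⟨_, ∑ i ∈ Finset.range n, C (c i) * X ^ i, ?_, rfl⟩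
    rw [aeval_eq_sum_range' hdeg, map_sum]
    refine Finset.sum_congr rfl fun i hi => ?_
    have hc : algebraMap ℤ_[p] ℚ_[p] (c i) = g.coeff i := by
      have : c i = ⟨g.coeff i, h i hi⟩ := dif_pos (h i hi)
      rw [this]
      rfl
    rw [map_mul, map_pow, aeval_X, aeval_C, Algebra.smul_def, ← hc,
      ← IsScalarTower.algebraMap_apply]
  have hterm : ∀ i, ‖g.coeff i • π ^ i‖ = ‖g.coeff i‖ * ‖π‖ ^ i := fun i => by
    rw [norm_smul, norm_pow]
  have hcoef : ∀ i, g.coeff i ≠ 0 →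
      ord (g.coeff i • π ^ i) = (g.coeff i).valuation + i * ord π := fun i hi => by
    rw [Algebra.smul_def, ord_mul (by simpa using hi) (pow_ne_zero _ hπ0), ord_algebraMap hi,
      ord_pow]
  have hdist : ∀ i ∈ Finset.range n, ∀ j ∈ Finset.range n, i ≠ j → g.coeff i ≠ 0 →
      ‖g.coeff i • π ^ i‖ ≠ ‖g.coeff j • π ^ j‖ := by
    intro i hi j hj hij hci h
    rw [Finset.mem_range] at hi hj
    have hcj : g.coeff j ≠ 0 := by
      intro hcj
      rw [hcj, zero_smul, norm_zero, norm_eq_zero] at h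
      exact smul_ne_zero hci (pow_ne_zero _ hπ0) h
    have h1 : ord (g.coeff i • π ^ i) = ord (g.coeff j • π ^ j) := by rw [ord, ord, h]
    rw [hcoef i hci, hcoef j hcj] at h1
    -- Multiplying by `n` clears denominators, since `n * ord π = 1`; the equality can then be read
    -- modulo `n`.
    have h2 : (n : ℝ) * (g.coeff i).valuation + i = n * (g.coeff j).valuation + j := by
      linear_combination n * h1 + (j - i : ℝ) * hord
    have h3 : (n : ℤ) * (g.coeff i).valuation + i = n * (g.coeff j).valuation + j := by
      exact_mod_cast h2
    have h4 : (i : ℤ) % n = j % n := by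
      have := congrArg (· % (n : ℤ)) h3
      simpa using this
    rw [Int.emod_eq_of_lt (by omega) (by omega), Int.emod_eq_of_lt (by omega) (by omega)] at h4
    exact hij (by exact_mod_cast h4)
  obtain ⟨k, hk, hmax⟩ := Finset.exists_max_image (Finset.range n)
    (fun i => ‖g.coeff i • π ^ i‖) ⟨0, Finset.mem_range.2 (Nat.pos_of_ne_zero hn)⟩
  have hle : ∀ i ∈ Finset.range n, ‖g.coeff i • π ^ i‖ ≤ 1 := by
    intro i hi
    by_cases hck : g.coeff k = 0
    · refine (hmax i hi).trans ?_
      simp [hck]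
    · refine (hmax i hi).trans ?_
      rw [aeval_eq_sum_range' hdeg, norm_sum_eq_of_lt hk] at hx1
      · exact hx1
      · exact fun j hj hjk => lt_of_le_of_ne (hmax j hj) (hdist k hk j hj hjk.symm hck).symm
  intro i hi
  by_cases hci : g.coeff i = 0
  · simp [hci]
  rw [Padic.norm_le_one_iff_val_nonneg]
  have h1 := hle i hi
  rw [← norm_one (α := PadicAlgCl p), norm_le_norm_iff_ord_le
    (smul_ne_zero hci (pow_ne_zero _ hπ0)) one_ne_zero, hcoef i hci] at h1
  have h2 : ord (1 : PadicAlgCl p) = 0 := by simp [ord]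
  have h3 : (0 : ℝ) ≤ n * (g.coeff i).valuation + i := by
    have := mul_le_mul_of_nonneg_left h1 (Nat.cast_nonneg (α := ℝ) n)
    rw [h2] at this
    linear_combination this + (i : ℝ) * hord
  have h4 : (0 : ℤ) ≤ n * (g.coeff i).valuation + i := by exact_mod_cast h3
  rw [Finset.mem_range] at hi
  by_contra! h5
  have h6 : (n : ℤ) * (g.coeff i).valuation ≤ n * (-1) :=
    mul_le_mul_of_nonneg_left (by omega) (by omega)
  omega

end Field

end PadicExt

/-! ### Finiteness of the set of totally ramified extensions of given degree. -/

namespace PadicExt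

open Polynomial IntermediateField

variable {p : ℕ} [Fact p.Prime]

/-- The monic polynomial of degree `n` with the given lower coefficients. -/
noncomputable def monicPoly {n : ℕ} (c : Fin n → ℤ_[p]) : ℤ_[p][X] :=
  X ^ n + ∑ i : Fin n, C (c i) * X ^ (i : ℕ)

section monicPoly

variable {n : ℕ} (c : Fin n → ℤ_[p])

theorem degree_sum_lt : (∑ i : Fin n, C (c i) * X ^ (i : ℕ)).degree < (n : WithBot ℕ) :=
  degree_sum_fin_lt c

theorem monic_monicPoly : (monicPoly c).Monic := monic_X_pow_add (degree_sum_lt c)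

theorem natDegree_monicPoly : (monicPoly c).natDegree = n := by
  apply natDegree_eq_of_degree_eq_some
  rw [monicPoly, degree_add_eq_left_of_degree_lt, degree_X_pow]
  rw [degree_X_pow]
  exact degree_sum_lt c

theorem coeff_monicPoly (i : Fin n) : (monicPoly c).coeff i = c i := by
  have h : (i : ℕ) ≠ n := i.2.ne
  simp [monicPoly, coeff_X_pow, h, Fin.val_inj]

/-- The leading terms cancel, and by the ultrametric inequality evaluation at an integral point is
1-Lipschitz in the coefficients. -/
theorem norm_aeval_monicPoly_sub_lt {c c' : Fin n → ℤ_[p]} {ε : ℝ}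
    (h : ‖c - c'‖ < ε) {α : PadicAlgCl p} (hα : ‖α‖ ≤ 1) :
    ‖aeval α (monicPoly c) - aeval α (monicPoly c')‖ < ε := by
  refine lt_of_le_of_lt ?_ h
  have : aeval α (monicPoly c) - aeval α (monicPoly c') =
      ∑ i : Fin n, algebraMap ℤ_[p] (PadicAlgCl p) ((c - c') i) * α ^ (i : ℕ) := by
    simp [monicPoly, map_sum, ← Finset.sum_sub_distrib, sub_mul]
  rw [this]
  refine norm_sum_le_of_forall_le (norm_nonneg _) fun i _ => ?_
  rw [norm_mul, norm_algebraMap_padicInt, norm_pow]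
  exact (mul_le_of_le_one_right (norm_nonneg _) (pow_le_one₀ (norm_nonneg _) hα)).trans
    (norm_le_pi_norm _ i)

end monicPoly

/-- Coefficient vectors of Eisenstein polynomials of degree `n`. -/
def eisensteinVectors (p n : ℕ) [Fact p.Prime] : Set (Fin n → ℤ_[p]) :=
  {c | ∀ i, ‖c i‖ ≤ (p : ℝ)⁻¹ ∧ ((i : ℕ) = 0 → ‖c i‖ = (p : ℝ)⁻¹)}

theorem isCompact_eisensteinVectors (n : ℕ) : IsCompact (eisensteinVectors p n) := by
  apply IsClosed.isCompact
  rw [eisensteinVectors, Set.ofPred_forall]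
  refine isClosed_iInter fun i => ?_
  rw [Set.ofPred_and]
  refine IsClosed.inter (isClosed_le (by fun_prop) continuous_const) ?_
  by_cases hi : (i : ℕ) = 0
  · simpa [hi] using isClosed_eq (f := fun c : Fin n → ℤ_[p] => ‖c i‖) (by fun_prop)
      continuous_const
  · simp [hi]

theorem irreducible_monicPoly {n : ℕ} (hn : n ≠ 0) {c : Fin n → ℤ_[p]}
    (hc : c ∈ eisensteinVectors p n) : Irreducible ((monicPoly c).map (algebraMap ℤ_[p] ℚ_[p])) := by
  have hp1 : (p : ℝ)⁻¹ < 1 := inv_lt_one_of_one_lt₀ one_lt_cast_prime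
  have hd := natDegree_monicPoly c
  refine irreducible_map_of_eisenstein (monic_monicPoly c) (by omega) (fun i hi => ?_) ?_
  · rw [hd] at hi
    exact (coeff_monicPoly c ⟨i, hi⟩) ▸ (hc ⟨i, hi⟩).1.trans_lt hp1
  · exact (coeff_monicPoly c ⟨0, Nat.pos_of_ne_zero hn⟩) ▸ (hc ⟨0, Nat.pos_of_ne_zero hn⟩).2 rfl

/-- Since `f(α)` is the product of the `α - β` over the roots `β`, a value smaller than `δ ^ deg f`
forces some factor below `δ`. -/
theorem exists_norm_sub_lt_of_norm_aeval_lt {f : ℚ_[p][X]} (hf : f.Monic) {α : PadicAlgCl p}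
    {δ : ℝ} (hδ : 0 < δ) (h : ‖aeval α f‖ < δ ^ f.natDegree) :
    ∃ β : PadicAlgCl p, aeval β f = 0 ∧ ‖β - α‖ < δ := by
  by_contra! hcon
  refine absurd h (not_lt.2 ?_)
  have hs : (f.map (algebraMap ℚ_[p] (PadicAlgCl p))).Splits := IsAlgClosed.splits _
  have hcard : (f.aroots (PadicAlgCl p)).card = f.natDegree := by
    rw [aroots_def, ← hs.natDegree_eq_card_roots, natDegree_map]
  have hprod : aeval α f = ((f.aroots (PadicAlgCl p)).map (fun β => α - β)).prod := by
    rw [← eval_map_algebraMap]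
    conv_lhs => rw [hs.eq_prod_roots_of_monic (hf.map _)]
    rw [eval_multiset_prod, Multiset.map_map]
    simp [aroots_def]
  have key : ∀ s : Multiset (PadicAlgCl p), (∀ β ∈ s, δ ≤ ‖β - α‖) →
      δ ^ s.card ≤ ‖(s.map (fun β => α - β)).prod‖ := by
    intro s
    induction s using Multiset.induction_on with
    | empty => simp
    | cons b s ih =>
      intro hb
      rw [Multiset.card_cons, Multiset.map_cons, Multiset.prod_cons, norm_mul, pow_succ']
      have h1 := hb b (Multiset.mem_cons_self b s)
      rw [norm_sub_rev] at h1
      exact mul_le_mul h1 (ih fun β hβ => hb β (Multiset.mem_cons_of_mem hβ)) (by positivity)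
        (norm_nonneg _)
  rw [hprod, ← hcard]
  exact key _ fun β hβ => hcon β (mem_aroots.1 hβ).2

theorem exists_pos_le_norm_sub (s : Set (PadicAlgCl p)) (hs : s.Finite) :
    ∃ δ > 0, ∀ β ∈ s, ∀ β' ∈ s, β ≠ β' → δ ≤ ‖β - β'‖ := by
  classical
  let t := (hs.toFinset ×ˢ hs.toFinset).filter (fun q => q.1 ≠ q.2)
  by_cases ht : t.Nonempty
  · obtain ⟨q, hq, hmin⟩ := t.exists_min_image (fun q => ‖q.1 - q.2‖) ht
    refine ⟨‖q.1 - q.2‖, ?_, fun β hβ β' hβ' hne => ?_⟩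
    · exact norm_pos_iff.2 (sub_ne_zero.2 (Finset.mem_filter.1 hq).2)
    · exact hmin (β, β') (by simp [t, hβ, hβ', hne])
  · refine ⟨1, one_pos, fun β hβ β' hβ' hne => (ht ⟨(β, β'), ?_⟩).elim⟩
    simp [t, hβ, hβ', hne]

/-- The fields of degree `n` generated by an integral root of a monic polynomial with coefficient
vector in `S`. -/
def rootFields {n : ℕ} (S : Set (Fin n → ℤ_[p])) : Set (IntermediateField ℚ_[p] (PadicAlgCl p)) :=
  {K | Module.finrank ℚ_[p] K = n ∧ ∃ c ∈ S, ∃ α : PadicAlgCl p, ‖α‖ ≤ 1 ∧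
    aeval α (monicPoly c) = 0 ∧ ℚ_[p]⟮α⟯ = K}

/-- Let `δ` be a lower bound for the distances between distinct roots of the Eisenstein polynomial
`f` of `c`. A root `α` of a polynomial within `δ ^ n` of `f` lies within `δ` of some root `β` of
`f`, so Krasner's lemma gives `β ∈ ℚ_p(α)`; both fields have degree `n`, so they coincide. Only the
finitely many fields `ℚ_p(β)` occur. -/
theorem exists_nhds_finite_rootFields {n : ℕ} (hn : n ≠ 0) {c : Fin n → ℤ_[p]}
    (hc : c ∈ eisensteinVectors p n) : ∃ U ∈ nhds c, (rootFields U).Finite := by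
  set f := (monicPoly c).map (algebraMap ℤ_[p] ℚ_[p]) with hf
  have hirr : Irreducible f := irreducible_monicPoly hn hc
  have hmon : f.Monic := (monic_monicPoly c).map _
  have hdeg : f.natDegree = n := by
    rw [hf, (monic_monicPoly c).natDegree_map, natDegree_monicPoly]
  have hroots : {β : PadicAlgCl p | aeval β f = 0}.Finite := by
    classical
    refine (f.aroots (PadicAlgCl p)).toFinset.finite_toSet.subset fun β hβ => ?_
    simpa [mem_aroots, hirr.ne_zero] using hβ
  obtain ⟨δ, hδ, hsep⟩ := exists_pos_le_norm_sub _ hroots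
  refine ⟨Metric.ball c (δ ^ n), Metric.ball_mem_nhds _ (by positivity),
    (hroots.image fun β => ℚ_[p]⟮β⟯).subset ?_⟩
  rintro K ⟨hK, c', hc', α, hα, hα0, rfl⟩
  have h1 : ‖aeval α f‖ < δ ^ f.natDegree := by
    rw [hdeg, hf, aeval_map_algebraMap]
    have := norm_aeval_monicPoly_sub_lt (c := c') (c' := c)
      (by rw [← dist_eq_norm]; exact hc') hα
    rwa [hα0, zero_sub, norm_neg] at this
  obtain ⟨β, hβ, hβα⟩ := exists_norm_sub_lt_of_norm_aeval_lt hmon hδ h1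
  have hmin : minpoly ℚ_[p] β = f := (minpoly.eq_of_irreducible_of_monic hirr hβ hmon).symm
  have hαint : IsIntegral ℚ_[p] α := Algebra.IsIntegral.isIntegral α
  have hβint : IsIntegral ℚ_[p] β := Algebra.IsIntegral.isIntegral β
  have hmem : β ∈ ℚ_[p]⟮α⟯ := by
    refine IsKrasner.krasner (minpoly.irreducible hβint).separable (IsAlgClosed.splits _) hαint
      fun β' hβ' hne => hβα.trans_le (hsep β hβ β' ?_ hne)
    have h2 : minpoly ℚ_[p] β = minpoly ℚ_[p] β' := hβ'
    show aeval β' f = 0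
    rw [← hmin, h2, minpoly.aeval]
  refine ⟨β, hβ, ?_⟩
  have : FiniteDimensional ℚ_[p] ℚ_[p]⟮α⟯ := IntermediateField.adjoin.finiteDimensional hαint
  refine IntermediateField.eq_of_le_of_finrank_eq (adjoin_simple_le_iff.2 hmem) ?_
  rw [hK, IntermediateField.adjoin.finrank hβint, hmin, hdeg]

theorem finite_rootFields_eisensteinVectors {n : ℕ} (hn : n ≠ 0) :
    (rootFields (eisensteinVectors p n)).Finite := by
  refine (isCompact_eisensteinVectors n).induction_on (p := fun S => (rootFields S).Finite)
    ?_ ?_ ?_ ?_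
  · simp [rootFields]
  · rintro S T hST hT
    refine hT.subset ?_
    rintro K ⟨hK, c, hc, h⟩
    exact ⟨hK, c, hST hc, h⟩
  · rintro S T hS hT
    refine (hS.union hT).subset ?_
    rintro K ⟨hK, c, hc | hc, h⟩
    · exact Or.inl ⟨hK, c, hc, h⟩
    · exact Or.inr ⟨hK, c, hc, h⟩
  · intro c hc
    obtain ⟨U, hU, hfin⟩ := exists_nhds_finite_rootFields hn hc
    exact ⟨U, mem_nhdsWithin_of_mem_nhds hU, hfin⟩

/-- The norm of `x` is the spectral norm, that is, the supremum of `‖a_i‖ ^ (1 / (d - i))` over the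
coefficients `a_i` of the minimal polynomial of degree `d`. -/
theorem norm_coeff_minpoly_le {x : PadicAlgCl p} {i : ℕ}
    (hi : i < (minpoly ℚ_[p] x).natDegree) (hx : ‖x‖ < 1) : ‖(minpoly ℚ_[p] x).coeff i‖ < 1 := by
  have h : spectralValueTerms (minpoly ℚ_[p] x) i ≤ ‖x‖ :=
    le_ciSup (spectralValueTerms_bddAbove (minpoly ℚ_[p] x)) i
  rw [spectralValueTerms_of_lt_natDegree _ hi] at h
  by_contra! hge
  have := Real.one_le_rpow hge (z := 1 / ((minpoly ℚ_[p] x).natDegree - i : ℝ)) (by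
    have : (i : ℝ) < (minpoly ℚ_[p] x).natDegree := by exact_mod_cast hi
    exact one_div_nonneg.2 (by linarith))
  linarith

theorem IsTotallyRamified.exists_uniformizer {K : IntermediateField ℚ_[p] (PadicAlgCl p)}
    (hK : IsTotallyRamified K) : ∃ π ∈ K, ‖π‖ ^ Module.finrank ℚ_[p] K = (p : ℝ)⁻¹ := by
  have := hK.1
  have hn : (Module.finrank ℚ_[p] K : ℝ) ≠ 0 := by exact_mod_cast Module.finrank_pos.ne'
  have h : (Module.finrank ℚ_[p] K : ℝ)⁻¹ ∈ valueGroup K := by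
    rw [hK.valueGroup_eq]; exact AddSubgroup.mem_zmultiples _
  obtain ⟨π, hπ, hord⟩ := h
  have h0 : (π : PadicAlgCl p) ≠ 0 := by simpa using hπ
  refine ⟨π, π.2, ?_⟩
  rw [← norm_pow, norm_eq_rpow_neg_ord (pow_ne_zero _ h0), ord_pow, hord, mul_inv_cancel₀ hn,
    Real.rpow_neg_one]

/-- The minimal polynomial of a uniformizer is Eisenstein, and a uniformizer generates `K`. -/
theorem IsTotallyRamified.mem_rootFields {K : IntermediateField ℚ_[p] (PadicAlgCl p)}
    (hK : IsTotallyRamified K) :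
    K ∈ rootFields (eisensteinVectors p (Module.finrank ℚ_[p] K)) := by
  have := hK.1
  have hn : Module.finrank ℚ_[p] K ≠ 0 := Module.finrank_pos.ne'
  obtain ⟨π, hπK, hπ⟩ := hK.exists_uniformizer
  have hxint : IsIntegral ℚ_[p] π := Algebra.IsIntegral.isIntegral π
  have hd := natDegree_minpoly_uniformizer hπK hπ
  have hlt := norm_uniformizer_lt_one hn hπ
  have h0 := norm_pow_natDegree_minpoly π
  rw [hd, hπ] at h0
  have hcoeff : ∀ i : Fin (Module.finrank ℚ_[p] K), ‖(minpoly ℚ_[p] π).coeff i‖ < 1 := fun i =>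
    norm_coeff_minpoly_le (by rw [hd]; exact i.2) hlt
  let c : Fin (Module.finrank ℚ_[p] K) → ℤ_[p] := fun i =>
    ⟨(minpoly ℚ_[p] π).coeff i, (hcoeff i).le⟩
  refine ⟨rfl, c, fun i => ⟨?_, fun hi => ?_⟩, π, hlt.le, ?_, adjoin_uniformizer hπK hπ⟩
  · have h1 : ‖c i‖ < 1 := hcoeff i
    rw [PadicInt.norm_lt_one_iff_dvd, ← Ideal.mem_span_singleton] at h1
    have := (PadicInt.norm_le_pow_iff_mem_span_pow (c i) 1).2 (by simpa using h1)
    simpa using this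
  · show ‖(minpoly ℚ_[p] π).coeff i‖ = _
    rw [hi, ← h0]
  · have : (monicPoly c).map (algebraMap ℤ_[p] ℚ_[p]) = minpoly ℚ_[p] π := by
      conv_rhs => rw [(minpoly.monic hxint).as_sum, hd, Finset.sum_range]
      simp only [monicPoly, Polynomial.map_add, Polynomial.map_pow, map_X, Polynomial.map_sum,
        Polynomial.map_mul, map_C]
      rfl
    rw [← aeval_map_algebraMap ℚ_[p], this, minpoly.aeval]

theorem finite_totRam_finrank_eq (n : ℕ) :
    {K : TotRam p | Module.finrank ℚ_[p] K.1 = n}.Finite := by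
  rcases eq_or_ne n 0 with rfl | hn
  · convert Set.finite_empty
    ext K
    have := K.2.1
    simpa using Module.finrank_pos.ne'
  · refine Set.Finite.of_finite_image ((finite_rootFields_eisensteinVectors hn).subset ?_)
      Subtype.val_injective.injOn
    rintro _ ⟨K, rfl, rfl⟩
    exact K.2.mem_rootFields

end PadicExt

/-! ### The translation of formulas, its free variables and its quantifier shape. -/

namespace Lval

/-- Negation. -/
def Formula.neg (φ : Formula) : Formula := φ.imp .falsum

/-- Conjunction. -/
def Formula.conj (φ ψ : Formula) : Formula := (φ.imp ψ.neg).neg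

/-- The numeral `1 + ⋯ + 1` in the field sort. -/
def Term.numeral : ℕ → Term .K
  | 0 => .zeroK
  | k + 1 => .addK (numeral k) .oneK

/-- `a ≡ b` modulo `p`, provided that the variable `x_0` of the field sort takes the value `-1`. -/
def Formula.congr (p : ℕ) (a b : Term .K) : Formula :=
  (Formula.lt (.v (.addK a (.mulK (.var .K 0) b))) (.v (Term.numeral p))).neg

/-- `v(x_1), …, v(x_m) ≥ 0` and `φ`. -/
def Formula.integral : ℕ → Formula → Formula
  | 0, φ => φ
  | m + 1, φ => .conj (Formula.neg (.lt (.v (.var .K (m + 1))) .zeroΓ)) (integral m φ)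

/-- Existential quantification over the variables `x_0, …, x_{j-1}` of the field sort. -/
def Formula.exK : ℕ → Formula → Formula
  | 0, φ => φ
  | j + 1, φ => .ex .K j (exK j φ)

/-- The variable `γ_0` is not larger than `γ_1` if the latter is positive, `γ_0` is positive, and
`x_0 = -1`. -/
def Formula.setup (φ : Formula) : Formula :=
  .conj (.lt .zeroΓ (.var .Γ 0))
    (.conj (.imp (.lt .zeroΓ (.var .Γ 1)) (Formula.neg (.lt (.var .Γ 1) (.var .Γ 0))))
      (.conj (.eq (.addK (.var .K 0) .oneK) .zeroK) φ))

/-- The `∃∀`-closure of the translation `φ` of a quantifier-free formula in `m` variables. -/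
def Formula.closure (m : ℕ) (φ : Formula) : Formula :=
  .ex .Γ 0 (.exK (m + 1) (.all .Γ 1 (.setup (.integral m φ))))

/-- The field term that lifts a term of `L_t`; the variable `x_i` becomes `x_{i+1}`. -/
def liftTerm {m : ℕ} : LtP.Term (Empty ⊕ Fin m) → Term .K
  | .var (Sum.inl e) => e.elim
  | .var (Sum.inr i) => .var .K (i + 1)
  | .func LtFunc.zero _ => .zeroK
  | .func LtFunc.one _ => .oneK
  | .func LtFunc.t _ => .s (.var .Γ 0)
  | .func LtFunc.add ts => .addK (liftTerm (ts 0)) (liftTerm (ts 1))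
  | .func LtFunc.mul ts => .mulK (liftTerm (ts 0)) (liftTerm (ts 1))

/-- The translation of quantifier-free formulas: `P(τ)` becomes `τ ≡ s(v(τ))` modulo `p`. -/
def liftFormula (p : ℕ) {m : ℕ} : LtP.BoundedFormula Empty m → Formula
  | .falsum => .falsum
  | .equal a b => .congr p (liftTerm a) (liftTerm b)
  | .rel LtRel.P ts => .congr p (liftTerm (ts 0)) (.s (.v (liftTerm (ts 0))))
  | .imp φ ψ => .imp (liftFormula p φ) (liftFormula p ψ)
  -- A default value: only quantifier-free formulas are meant to be translated.
  | .all _ => .falsum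

section Realize

variable {M : Str} {a : M.Assignment}

theorem Formula.realize_neg {φ : Formula} : φ.neg.Realize M a ↔ ¬ φ.Realize M a := Iff.rfl

theorem Formula.realize_conj {φ ψ : Formula} :
    (φ.conj ψ).Realize M a ↔ φ.Realize M a ∧ ψ.Realize M a := by
  simp only [conj, realize_neg, Realize, Classical.not_imp, not_not]

theorem Formula.realize_integral {m : ℕ} {φ : Formula} :
    (φ.integral m).Realize M a ↔
      (∀ i < m, ¬ M.ltΓ (M.v (a (.K, i + 1))) M.zeroΓ) ∧ φ.Realize M a := by
  induction m with
  | zero => simp [integral]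
  | succ m ih =>
    simp only [integral, realize_conj, ih, realize_neg, Realize, Term.eval, Nat.lt_succ_iff_lt_or_eq,
      or_imp, forall_and, forall_eq]
    tauto

/-- Replaces the nested quantifiers by one assignment that may differ from `a` only at the
quantified variables. -/
theorem Formula.realize_exK {j : ℕ} {φ : Formula} :
    (φ.exK j).Realize M a ↔
      ∃ a' : M.Assignment, (∀ x, (∀ i < j, x ≠ (.K, i)) → a' x = a x) ∧ φ.Realize M a' := by
  classical
  induction j generalizing a with
  | zero =>
    simp only [exK, not_lt_zero, false_imp_iff, implies_true, true_imp_iff]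
    exact ⟨fun h => ⟨a, fun _ => rfl, h⟩, fun ⟨a', h, h'⟩ => (funext h : a' = a) ▸ h'⟩
  | succ j ih =>
    simp only [exK, Realize, ih]
    constructor
    · rintro ⟨m, a', h, h'⟩
      refine ⟨a', fun x hx => ?_, h'⟩
      rw [h x fun i hi => hx i (by omega), Function.update_of_ne (hx j (by omega))]
    · rintro ⟨a', h, h'⟩
      refine ⟨a' (.K, j), a', fun x hx => ?_, h'⟩
      by_cases hj : x = (.K, j)
      · subst hj; simp
      · rw [Function.update_of_ne hj]
        refine h x fun i hi => ?_
        rcases Nat.lt_succ_iff_lt_or_eq.1 hi with hi | rfl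
        · exact hx i hi
        · exact hj

end Realize

section FreeVars

theorem Term.vars_numeral (k : ℕ) : (Term.numeral k).vars = ∅ := by
  induction k with
  | zero => rfl
  | succ k ih => simp [numeral, vars, ih]

/-- The variables that occur free in the translations of formulas in `m` variables. -/
def liftVars (m : ℕ) : Set (Srt × ℕ) := {x | x = (.Γ, 0) ∨ ∃ i ≤ m, x = (.K, i)}

theorem vars_liftTerm {m : ℕ} (τ : LtP.Term (Empty ⊕ Fin m)) :
    (liftTerm τ).vars ⊆ liftVars m := by
  induction τ with
  | var x =>
    rcases x with e | i
    · exact e.elim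
    · simp only [liftTerm, Term.vars, Set.singleton_subset_iff]
      exact Or.inr ⟨i + 1, i.2, rfl⟩
  | func f ts ih =>
    cases f
    · simp [liftTerm, Term.vars]
    · simp [liftTerm, Term.vars]
    · simp [liftTerm, Term.vars, liftVars]
    · exact Set.union_subset (ih 0) (ih 1)
    · exact Set.union_subset (ih 0) (ih 1)

theorem freeVars_congr {p m : ℕ} {a b : Term .K} (ha : a.vars ⊆ liftVars m)
    (hb : b.vars ⊆ liftVars m) : (Formula.congr p a b).freeVars ⊆ liftVars m := by
  have h0 : ((.K, 0) : Srt × ℕ) ∈ liftVars m := Or.inr ⟨0, Nat.zero_le _, rfl⟩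
  simp [Formula.congr, Formula.neg, Formula.freeVars, Term.vars, Term.vars_numeral, ha, hb, h0,
    Set.insert_subset_iff]

theorem freeVars_liftFormula (p : ℕ) {m : ℕ} (φ : LtP.BoundedFormula Empty m) :
    (liftFormula p φ).freeVars ⊆ liftVars m := by
  induction φ with
  | falsum => simp [liftFormula, Formula.freeVars]
  | equal a b => exact freeVars_congr (vars_liftTerm a) (vars_liftTerm b)
  | rel R ts =>
    cases R
    exact freeVars_congr (vars_liftTerm (ts 0)) (vars_liftTerm (ts 0))
  | imp φ ψ ih ih' => exact Set.union_subset ih ih'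
  | all φ _ => simp [liftFormula, Formula.freeVars]

theorem freeVars_integral {m k : ℕ} (hk : k ≤ m) {φ : Formula} (h : φ.freeVars ⊆ liftVars m) :
    (φ.integral k).freeVars ⊆ liftVars m := by
  induction k with
  | zero => exact h
  | succ k ih =>
    have h1 : ((.K, k + 1) : Srt × ℕ) ∈ liftVars m := Or.inr ⟨k + 1, hk, rfl⟩
    simp [Formula.integral, Formula.conj, Formula.neg, Formula.freeVars, Term.vars,
      Set.insert_subset_iff, h1, ih (by omega)]

theorem freeVars_exK (j : ℕ) (φ : Formula) :
    (φ.exK j).freeVars ⊆ {x ∈ φ.freeVars | ∀ i < j, x ≠ (.K, i)} := by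
  induction j with
  | zero => intro x hx; exact ⟨hx, fun _ h => absurd h (Nat.not_lt_zero _)⟩
  | succ j ih =>
    rintro x ⟨hx, hxj⟩
    refine ⟨(ih hx).1, fun i hi => ?_⟩
    rcases Nat.lt_succ_iff_lt_or_eq.1 hi with hi | rfl
    · exact (ih hx).2 i hi
    · exact hxj

theorem isSentence_closure {m : ℕ} {φ : Formula} (h : φ.freeVars ⊆ liftVars m) :
    (φ.closure m).IsSentence := by
  rw [Formula.IsSentence, Set.eq_empty_iff_forall_notMem]
  rintro x ⟨hx, hx0⟩
  obtain ⟨⟨hx, hx1⟩, hxK⟩ := freeVars_exK _ _ hx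
  have h2 : (Formula.setup (φ.integral m)).freeVars ⊆ liftVars m ∪ {(.Γ, 1)} := by
    have h3 := freeVars_integral le_rfl h
    have h4 : ((.K, 0) : Srt × ℕ) ∈ liftVars m := Or.inr ⟨0, Nat.zero_le _, rfl⟩
    have h5 : ((.Γ, 0) : Srt × ℕ) ∈ liftVars m := Or.inl rfl
    have h6 := h3.trans (Set.subset_insert ((.Γ, 1) : Srt × ℕ) _)
    simp [Formula.setup, Formula.conj, Formula.neg, Formula.freeVars, Term.vars,
      Set.insert_subset_iff, h4, h5, h6]
  rcases h2 hx with (h | ⟨i, hi, h⟩) | h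
  · exact hx0 h
  · exact hxK i (by omega) h
  · exact hx1 h

end FreeVars

section Shape

theorem Formula.IsQF.neg {φ : Formula} (h : φ.IsQF) : φ.neg.IsQF := .imp h .falsum

theorem Formula.IsQF.conj {φ ψ : Formula} (h : φ.IsQF) (h' : ψ.IsQF) : (φ.conj ψ).IsQF :=
  (IsQF.imp h h'.neg).neg

theorem Formula.isQF_congr (p : ℕ) (a b : Term .K) : (Formula.congr p a b).IsQF :=
  (IsQF.lt _ _).neg

theorem Formula.IsQF.integral {φ : Formula} (h : φ.IsQF) (m : ℕ) : (φ.integral m).IsQF := by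
  induction m with
  | zero => exact h
  | succ m ih => exact (IsQF.lt _ _).neg.conj ih

theorem Formula.IsQF.setup {φ : Formula} (h : φ.IsQF) : φ.setup.IsQF :=
  (IsQF.lt _ _).conj ((IsQF.imp (.lt _ _) (IsQF.lt _ _).neg).conj ((IsQF.eq _ _).conj h))

theorem isQF_liftFormula (p : ℕ) {m : ℕ} (φ : LtP.BoundedFormula Empty m) :
    (liftFormula p φ).IsQF := by
  induction φ with
  | falsum => exact .falsum
  | equal a b => exact Formula.isQF_congr _ _ _
  | rel R ts => cases R; exact Formula.isQF_congr _ _ _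
  | imp φ ψ ih ih' => exact .imp ih ih'
  | all φ _ => exact .falsum

theorem Formula.IsExistsForall.exK {φ : Formula} (h : φ.IsExistsForall) (j : ℕ) :
    (φ.exK j).IsExistsForall := by
  induction j with
  | zero => exact h
  | succ j ih => exact .ex _ _ ih

theorem Formula.IsQF.isExistsForall_closure {φ : Formula} (h : φ.IsQF) (m : ℕ) :
    (φ.closure m).IsExistsForall :=
  .ex _ _ (IsExistsForall.exK (.of_isUniversal (.all _ _ (.of_isQF (h.integral m).setup))) _)

end Shape

end Lval

/-! ### Valuation, cross-section and least positive value in a totally ramified field. -/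

namespace PadicExt

open Lval

variable {p : ℕ} [Fact p.Prime]

section val

variable {K : IntermediateField ℚ_[p] (PadicAlgCl p)}

theorem val_le_val_iff {x y : K} :
    val K x ≤ val K y ↔ ‖(y : PadicAlgCl p)‖ ≤ ‖(x : PadicAlgCl p)‖ := by
  by_cases hx : x = 0
  · by_cases hy : y = 0
    · simp [hx, hy]
    · have : (y : PadicAlgCl p) ≠ 0 := by simpa using hy
      simp [val, hx, hy]
  · by_cases hy : y = 0
    · simp [val, hx, hy]
    · have hx' : (x : PadicAlgCl p) ≠ 0 := by simpa using hx
      have hy' : (y : PadicAlgCl p) ≠ 0 := by simpa using hy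
      rw [norm_le_norm_iff_ord_le hy' hx']
      simp only [val, hx, hy, dif_neg, not_false_eq_true, WithTop.coe_le_coe]
      rfl

theorem val_lt_val_iff {x y : K} :
    val K x < val K y ↔ ‖(y : PadicAlgCl p)‖ < ‖(x : PadicAlgCl p)‖ := by
  rw [← not_le, val_le_val_iff, not_le]

theorem val_eq_val_iff {x y : K} :
    val K x = val K y ↔ ‖(x : PadicAlgCl p)‖ = ‖(y : PadicAlgCl p)‖ := by
  rw [le_antisymm_iff, val_le_val_iff, val_le_val_iff, and_comm, ← le_antisymm_iff]

theorem val_one : val K 1 = 0 := by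
  rw [val, dif_neg one_ne_zero, ← WithTop.coe_zero, WithTop.coe_inj]
  exact Subtype.ext (by simp [ord])

theorem val_ne_top {x : K} (hx : x ≠ 0) : val K x ≠ ⊤ := by simp [val, hx]

theorem CrossSection.val_ext (s : CrossSection K) (γ : WithTop (valueGroup K)) :
    val K (s.ext γ) = γ := by
  induction γ using WithTop.recTopCoe with
  | top => simp [CrossSection.ext, val]
  | coe γ => exact s.val_toHom γ

theorem CrossSection.norm_ext_val (s : CrossSection K) (x : K) :
    ‖(s.ext (val K x) : PadicAlgCl p)‖ = ‖(x : PadicAlgCl p)‖ :=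
  val_eq_val_iff.1 (s.val_ext _)

theorem CrossSection.ext_nsmul (s : CrossSection K) (k : ℕ) (γ : valueGroup K) :
    s.ext ((k • γ : valueGroup K) : WithTop (valueGroup K)) = s.ext γ ^ k := by
  simp [CrossSection.ext]

end val

/-- The least positive element of the value group. -/
noncomputable def IsTotallyRamified.minPos {K : IntermediateField ℚ_[p] (PadicAlgCl p)}
    (hK : IsTotallyRamified K) : valueGroup K :=
  ⟨(Module.finrank ℚ_[p] K : ℝ)⁻¹, hK.valueGroup_eq ▸ AddSubgroup.mem_zmultiples _⟩

theorem IsTotallyRamified.finrank_pos {K : IntermediateField ℚ_[p] (PadicAlgCl p)}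
    (hK : IsTotallyRamified K) : 0 < Module.finrank ℚ_[p] K := by
  have := hK.1
  exact Module.finrank_pos

section TotallyRamified

variable {K : IntermediateField ℚ_[p] (PadicAlgCl p)} (hK : IsTotallyRamified K)

theorem IsTotallyRamified.minPos_pos : 0 < hK.minPos := by
  have := hK.finrank_pos
  show (0 : ℝ) < (Module.finrank ℚ_[p] K : ℝ)⁻¹
  positivity

theorem IsTotallyRamified.exists_zsmul_minPos (γ : valueGroup K) : ∃ z : ℤ, γ = z • hK.minPos := by
  have h : (γ : ℝ) ∈ AddSubgroup.zmultiples ((Module.finrank ℚ_[p] K : ℝ)⁻¹) :=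
    hK.valueGroup_eq ▸ γ.2
  obtain ⟨z, hz⟩ := h
  exact ⟨z, Subtype.ext (by rw [← hz]; rfl)⟩

theorem IsTotallyRamified.exists_nsmul_minPos {γ : valueGroup K} (hγ : 0 ≤ γ) :
    ∃ k : ℕ, γ = k • hK.minPos := by
  obtain ⟨z, rfl⟩ := hK.exists_zsmul_minPos γ
  have hz : 0 ≤ z := by
    have h : (0 : ℝ) ≤ z • (Module.finrank ℚ_[p] K : ℝ)⁻¹ := hγ
    have hn : (0 : ℝ) < (Module.finrank ℚ_[p] K : ℝ)⁻¹ := hK.minPos_pos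
    rw [zsmul_eq_mul] at h
    exact_mod_cast nonneg_of_mul_nonneg_left h hn
  lift z to ℕ using hz
  exact ⟨z, by simp⟩

/-- The value group is cyclic, generated by `minPos`, so its least positive element is definable by
a universal formula. This is the only use of the universal quantifier. -/
theorem IsTotallyRamified.eq_minPos_iff {γ : WithTop (valueGroup K)} :
    (0 < γ ∧ ∀ δ : WithTop (valueGroup K), 0 < δ → ¬ δ < γ) ↔ γ = hK.minPos := by
  have hpos : (0 : WithTop (valueGroup K)) < hK.minPos := WithTop.coe_pos.2 hK.minPos_pos
  have hmin : ∀ δ : WithTop (valueGroup K), 0 < δ → (hK.minPos : WithTop _) ≤ δ := by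
    intro δ hδ
    induction δ using WithTop.recTopCoe with
    | top => exact le_top
    | coe δ =>
      rw [WithTop.coe_le_coe]
      have hδ' := WithTop.coe_pos.1 hδ
      obtain ⟨k, rfl⟩ := hK.exists_nsmul_minPos hδ'.le
      have hk : k ≠ 0 := by rintro rfl; simp at hδ'
      exact le_self_nsmul hK.minPos_pos.le hk
  constructor
  · rintro ⟨h0, h⟩
    exact le_antisymm (not_lt.1 (h _ hpos)) (hmin _ h0)
  · rintro rfl
    exact ⟨hpos, fun δ hδ => not_lt.2 (hmin δ hδ)⟩

theorem IsTotallyRamified.norm_ext_minPos (s : CrossSection K) :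
    ‖(s.ext hK.minPos : PadicAlgCl p)‖ ^ Module.finrank ℚ_[p] K = (p : ℝ)⁻¹ := by
  have hn : (Module.finrank ℚ_[p] K : ℝ) ≠ 0 := by exact_mod_cast hK.finrank_pos.ne'
  have h := s.val_ext hK.minPos
  have h0 : s.ext hK.minPos ≠ 0 := by
    intro h0
    simp [h0, val] at h
  have h0' : (s.ext hK.minPos : PadicAlgCl p) ≠ 0 := by simpa using h0
  rw [val, dif_neg h0, WithTop.coe_inj] at h
  have h1 : ord (s.ext hK.minPos : PadicAlgCl p) = (Module.finrank ℚ_[p] K : ℝ)⁻¹ :=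
    congrArg Subtype.val h
  rw [← norm_pow, norm_eq_rpow_neg_ord (pow_ne_zero _ h0'), ord_pow, h1, mul_inv_cancel₀ hn,
    Real.rpow_neg_one]

theorem IsTotallyRamified.exists_ext_val_eq_pow (s : CrossSection K) {x : K} (hx : x ≠ 0)
    (hx1 : ‖(x : PadicAlgCl p)‖ ≤ 1) : ∃ k : ℕ, s.ext (val K x) = s.ext hK.minPos ^ k := by
  have h : val K 1 ≤ val K x := val_le_val_iff.2 (by simpa using hx1)
  rw [val_one] at h
  obtain ⟨γ, hγ⟩ := WithTop.ne_top_iff_exists.1 (val_ne_top hx)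
  rw [← hγ] at h ⊢
  obtain ⟨k, rfl⟩ := hK.exists_nsmul_minPos (WithTop.coe_nonneg.1 h)
  exact ⟨k, s.ext_nsmul k _⟩

theorem IsTotallyRamified.ext_val_pow (s : CrossSection K) (k : ℕ) :
    s.ext (val K (s.ext hK.minPos ^ k)) = s.ext hK.minPos ^ k := by
  rw [← s.ext_nsmul, s.val_ext]

/-- The correctness of the translation of `P`. For nonzero integral `x`, `s(v(x))` is a power `π ^
k`, which reduces to `t ^ k`. Conversely, if `x` reduces to `t ^ k` with `k < n`, then `x` and `π ^
k` differ by less than `‖π ^ k‖`, so they have the same value and `s(v(x)) = π ^ k`. If `x` reduces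
to `0`, both `x` and `s(v(x))` have norm at most `p⁻¹`. -/
theorem IsTotallyRamified.mem_powers_iff (s : CrossSection K) {x : K}
    {y : TruncPoly p (Module.finrank ℚ_[p] K)}
    (h : Reduces (s.ext hK.minPos : PadicAlgCl p) x y) :
    ‖(x : PadicAlgCl p) - s.ext (val K x)‖ ≤ (p : ℝ)⁻¹ ↔
      y = 0 ∨ ∃ k < Module.finrank ℚ_[p] K, y = TruncPoly.t p _ ^ k := by
  have hπ := hK.norm_ext_minPos s
  have hn := hK.finrank_pos.ne'
  have hpow : ∀ k : ℕ, Reduces (s.ext hK.minPos : PadicAlgCl p)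
      ((s.ext hK.minPos ^ k : K) : PadicAlgCl p)
      (TruncPoly.t p (Module.finrank ℚ_[p] K) ^ k) := fun k => by
    rw [IntermediateField.coe_pow]; exact .uniformizer_pow k
  constructor
  · intro hle
    by_cases hx : x = 0
    · left
      subst hx
      rw [← h.norm_sub_le_iff hn hπ .zero]
      simp
    · obtain ⟨k, hk⟩ := hK.exists_ext_val_eq_pow s hx (h.norm_le_one hn hπ)
      rw [hk, h.norm_sub_le_iff hn hπ (hpow k)] at hle
      rcases lt_or_ge k (Module.finrank ℚ_[p] K) with hkn | hkn
      · exact Or.inr ⟨k, hkn, hle⟩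
      -- The exponent `k` is not bounded by `n`; from `n` on the power of `t` is `0`, which also
      -- belongs to `P`.
      · exact Or.inl (hle.trans (TruncPoly_t_pow_eq_zero hkn))
  · rintro (rfl | ⟨k, hk, rfl⟩)
    · have h1 := (h.norm_sub_le_iff hn hπ .zero).2 rfl
      rw [sub_zero] at h1
      have h2 := s.norm_ext_val x
      rw [sub_eq_add_neg]
      refine (IsUltrametricDist.norm_add_le_max _ _).trans ?_
      rw [norm_neg, h2, max_self]
      exact h1
    · have h1 := (h.norm_sub_le_iff hn hπ (hpow k)).2 rfl
      have h2 : ‖((s.ext hK.minPos ^ k : K) : PadicAlgCl p)‖ = ‖(x : PadicAlgCl p)‖ := by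
        rw [← norm_neg (x : PadicAlgCl p)]
        apply IsUltrametricDist.norm_eq_of_add_norm_lt_max
        rw [← sub_eq_add_neg, norm_sub_rev]
        refine h1.trans_lt (lt_max_of_lt_left ?_)
        rw [IntermediateField.coe_pow, norm_pow, ← hπ]
        exact norm_uniformizer_pow_lt hn hπ hk
      rw [val_eq_val_iff.2 h2.symm, hK.ext_val_pow]
      exact h1

end TotallyRamified

end PadicExt

/-! ### Correctness of the translation in a single field. -/

namespace PadicExt

open Lval FirstOrder.Language

variable {p : ℕ} [Fact p.Prime] {K : IntermediateField ℚ_[p] (PadicAlgCl p)}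

/-- The value of a variable of the field sort. -/
def fieldVar (s : CrossSection K) (a : (padicStr K s).Assignment) (i : ℕ) : K := a (.K, i)

/-- The value of a variable of the value group sort. -/
def groupVar (s : CrossSection K) (a : (padicStr K s).Assignment) (i : ℕ) :
    WithTop (valueGroup K) := a (.Γ, i)

/-- The value of a field term. -/
noncomputable def evalK (s : CrossSection K) (a : (padicStr K s).Assignment) (τ : Lval.Term .K) :
    K := τ.eval (padicStr K s) a

theorem evalK_numeral (s : CrossSection K) (a : (padicStr K s).Assignment) (k : ℕ) :
    evalK s a (Term.numeral k) = k := by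
  induction k with
  | zero => simp [evalK, Term.numeral, Term.eval, padicStr]
  | succ k ih =>
    rw [Nat.cast_succ, ← ih]
    rfl

theorem norm_natCast_prime : ‖((p : K) : PadicAlgCl p)‖ = (p : ℝ)⁻¹ := by
  have : ((p : K) : PadicAlgCl p) = algebraMap ℚ_[p] (PadicAlgCl p) p := by simp
  rw [this, PadicAlgCl.norm_extends, Padic.norm_p]

theorem realize_congr (s : CrossSection K) {a : (padicStr K s).Assignment}
    (ha : fieldVar s a 0 = -1) (τ σ : Lval.Term .K) :
    (Formula.congr p τ σ).Realize (padicStr K s) a ↔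
      ‖(evalK s a τ : PadicAlgCl p) - evalK s a σ‖ ≤ (p : ℝ)⁻¹ := by
  have h : (Formula.congr p τ σ).Realize (padicStr K s) a ↔
      ¬ val K (evalK s a τ + fieldVar s a 0 * evalK s a σ) < val K (evalK s a (Term.numeral p)) :=
    Iff.rfl
  rw [h, ha, val_lt_val_iff, not_lt, evalK_numeral, norm_natCast_prime]
  simp [sub_eq_add_neg]

theorem reduces_liftTerm (hK : IsTotallyRamified K) (s : CrossSection K)
    {a : (padicStr K s).Assignment} (hΓ : groupVar s a 0 = hK.minPos) {m : ℕ}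
    {y : Fin m → TruncPoly p (Module.finrank ℚ_[p] K)}
    (hy : ∀ i : Fin m, Reduces (s.ext hK.minPos : PadicAlgCl p)
      (fieldVar s a ((i : ℕ) + 1) : PadicAlgCl p) (y i))
    (τ : LtP.Term (Empty ⊕ Fin m)) :
    Reduces (s.ext hK.minPos : PadicAlgCl p) (evalK s a (liftTerm τ))
      (τ.realize (Sum.elim default y)) := by
  induction τ with
  | var x =>
    rcases x with e | i
    · exact e.elim
    · exact hy i
  | func f ts ih =>
    cases f
    · exact .zero
    · exact .one
    · have : evalK s a (liftTerm (.func LtFunc.t ts)) = s.ext hK.minPos := by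
        rw [← hΓ]; rfl
      rw [this]
      exact .uniformizer
    · exact (ih 0).add (ih 1)
    · exact (ih 0).mul (ih 1)

theorem realize_liftFormula (hK : IsTotallyRamified K) (s : CrossSection K)
    {a : (padicStr K s).Assignment} (hΓ : groupVar s a 0 = hK.minPos) {m : ℕ}
    {y : Fin m → TruncPoly p (Module.finrank ℚ_[p] K)}
    (hy : ∀ i : Fin m, Reduces (s.ext hK.minPos : PadicAlgCl p)
      (fieldVar s a ((i : ℕ) + 1) : PadicAlgCl p) (y i))
    (ha : fieldVar s a 0 = -1) {φ : LtP.BoundedFormula Empty m}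
    (hφ : φ.IsQF) :
    (liftFormula p φ).Realize (padicStr K s) a ↔ φ.Realize default y := by
  have hn := hK.finrank_pos.ne'
  have hπ := hK.norm_ext_minPos s
  induction hφ with
  | falsum => exact Iff.rfl
  | of_isAtomic h =>
    cases h with
    | equal τ σ =>
      exact (realize_congr s ha _ _).trans ((reduces_liftTerm hK s hΓ hy τ).norm_sub_le_iff hn hπ
        (reduces_liftTerm hK s hΓ hy σ))
    | rel R ts =>
      cases R
      exact (realize_congr s ha _ _).trans
        (hK.mem_powers_iff s (reduces_liftTerm hK s hΓ hy (ts 0)))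
  | imp _ _ ih ih' => exact imp_congr ih ih'

theorem mem_of_aeval {π : PadicAlgCl p} (hπ : π ∈ K) (g : Polynomial ℤ_[p]) :
    Polynomial.aeval π g ∈ K := by
  have h : Polynomial.aeval π g =
      Polynomial.aeval π (g.map (algebraMap ℤ_[p] ℚ_[p])) := by
    rw [Polynomial.aeval_map_algebraMap]
  rw [h]
  have h1 : Algebra.adjoin ℚ_[p] {π} ≤ K.toSubalgebra :=
    Algebra.adjoin_le (Set.singleton_subset_iff.2 hπ)
  exact h1 (Polynomial.aeval_mem_adjoin_singleton _ _)

theorem realize_setup (s : CrossSection K) {φ : Formula} {a : (padicStr K s).Assignment} :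
    φ.setup.Realize (padicStr K s) a ↔
      0 < groupVar s a 0 ∧ (0 < groupVar s a 1 → ¬ groupVar s a 1 < groupVar s a 0) ∧
      fieldVar s a 0 + 1 = 0 ∧ φ.Realize (padicStr K s) a := by
  simp only [Formula.setup, Formula.realize_conj]
  exact Iff.rfl

/-- The setup formula forces `γ_0` to be `minPos`, hence `s(γ_0)` to be a uniformizer. Witnesses
then pass in both directions: integral elements of `K` reduce to `𝔽_p[t]/(t^n)`, and every element
of that ring lifts. -/
theorem models_closure_iff (hK : IsTotallyRamified K) (s : CrossSection K) {m : ℕ}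
    {φ : LtP.BoundedFormula Empty m} (hφ : φ.IsQF) :
    (padicStr K s).Models ((liftFormula p φ).closure m) ↔
      TruncPoly p (Module.finrank ℚ_[p] K) ⊨ φ.exs := by
  classical
  have := hK.1
  have hn := hK.finrank_pos.ne'
  have hπ := hK.norm_ext_minPos s
  have hmem : (s.ext hK.minPos : PadicAlgCl p) ∈ K := SetLike.coe_mem _
  have hexs : TruncPoly p (Module.finrank ℚ_[p] K) ⊨ φ.exs ↔
      ∃ y : Fin m → TruncPoly p (Module.finrank ℚ_[p] K), φ.Realize default y := by
    rw [Sentence.Realize, BoundedFormula.realize_exs]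
    exact exists_congr fun y =>
      iff_of_eq (congrArg (fun v => φ.Realize v y) (Subsingleton.elim _ _))
  have hsimp : ∀ {b : (padicStr K s).Assignment},
      (Formula.setup ((liftFormula p φ).integral m)).Realize (padicStr K s) b ↔
      0 < groupVar s b 0 ∧ (0 < groupVar s b 1 → ¬ groupVar s b 1 < groupVar s b 0) ∧
      fieldVar s b 0 + 1 = 0 ∧
      (∀ i < m, ‖(fieldVar s b (i + 1) : PadicAlgCl p)‖ ≤ 1) ∧
      (liftFormula p φ).Realize (padicStr K s) b := by
    intro b
    rw [realize_setup, Formula.realize_integral]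
    have : ∀ x : K, ¬ val K x < 0 ↔ ‖(x : PadicAlgCl p)‖ ≤ 1 := fun x => by
      rw [← val_one, val_lt_val_iff, not_lt]; simp
    have h2 : (∀ i < m, ¬ (padicStr K s).ltΓ ((padicStr K s).v (b (.K, i + 1)))
        (padicStr K s).zeroΓ) ↔ ∀ i < m, ‖(fieldVar s b (i + 1) : PadicAlgCl p)‖ ≤ 1 :=
      forall₂_congr fun i _ => this (fieldVar s b (i + 1))
    rw [h2]
  rw [hexs]
  constructor
  · intro h
    -- Truth quantifies over all assignments, so one has to be supplied; any would do.
    obtain ⟨γ, hγ⟩ := h fun x => match x with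
      | (.K, _) => (0 : K)
      | (.Γ, _) => (0 : WithTop (valueGroup K))
      | (.k, _) => (0 : ResField K)
    obtain ⟨a, -, ha⟩ := Formula.realize_exK.1 hγ
    have ha' := fun δ : WithTop (valueGroup K) => hsimp.1 (ha δ)
    have hΓ1 : ∀ δ : WithTop (valueGroup K),
        groupVar s (Function.update a (.Γ, 1) δ) 1 = δ := fun δ => Function.update_self _ _ _
    have hΓ0 : ∀ δ : WithTop (valueGroup K),
        groupVar s (Function.update a (.Γ, 1) δ) 0 = groupVar s a 0 := fun δ =>
      Function.update_of_ne (by simp) _ _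
    simp only [hΓ0, hΓ1] at ha'
    have hΓ := hK.eq_minPos_iff.1 ⟨(ha' 0).1, fun δ => (ha' δ).2.1⟩
    -- Once `γ_0` is known, the universal variable plays no role, so it is specialized to an
    -- arbitrary value.
    obtain ⟨-, -, hm1, hxint, hreal⟩ := ha' 0
    have hΓ' := (hΓ0 0).trans hΓ
    generalize Function.update a (.Γ, 1) (0 : WithTop (valueGroup K)) = b at hm1 hxint hreal hΓ'
    have hx : ∀ i : Fin m, ∃ y : TruncPoly p (Module.finrank ℚ_[p] K),
        Reduces (s.ext hK.minPos : PadicAlgCl p) (fieldVar s b ((i : ℕ) + 1) : PadicAlgCl p) y :=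
      fun i => exists_reduces_right hmem hπ (SetLike.coe_mem _) (hxint i i.2)
    choose y hy using hx
    exact ⟨y, (realize_liftFormula hK s hΓ' hy (eq_neg_of_add_eq_zero_left hm1) hφ).1 hreal⟩
  · rintro ⟨y, hy⟩ a
    have hx : ∀ i : Fin m, ∃ x : K, Reduces (s.ext hK.minPos : PadicAlgCl p) x (y i) := fun i => by
      obtain ⟨g, hg⟩ := exists_reduces_left (s.ext hK.minPos : PadicAlgCl p) (y i)
      exact ⟨⟨_, mem_of_aeval hmem g⟩, hg⟩
    choose x hx using hx
    let b : (padicStr K s).Assignment := fun z => match z with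
      | (.K, 0) => (-1 : K)
      | (.K, i + 1) => if h : i < m then x ⟨i, h⟩ else a (.K, i + 1)
      | (.Γ, i) => Function.update a (.Γ, 0) (hK.minPos : WithTop (valueGroup K)) (.Γ, i)
      | (.k, i) => a (.k, i)
    refine ⟨(hK.minPos : WithTop (valueGroup K)), Formula.realize_exK.2 ⟨b, ?_, ?_⟩⟩
    · rintro ⟨_ | _ | _, i⟩ hz
      · have hup : Function.update a (.Γ, 0) (hK.minPos : WithTop (valueGroup K)) (.K, i) =
            a (.K, i) := Function.update_of_ne (by simp) _ _
        refine Eq.trans ?_ hup.symm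
        rcases i with _ | i
        · exact absurd rfl (hz 0 (by omega))
        · have hi : ¬ i < m := fun hi => hz (i + 1) (by omega) rfl
          exact dif_neg hi
      · rfl
      · exact (Function.update_of_ne (by simp) _ _).symm
    · intro δ
      have hb0 : ∀ δ : WithTop (valueGroup K),
          groupVar s (Function.update b (.Γ, 1) δ) 0 = hK.minPos := fun δ =>
        (Function.update_of_ne (by simp) _ _).trans (Function.update_self _ _ _)
      have hb1 : ∀ δ : WithTop (valueGroup K),
          groupVar s (Function.update b (.Γ, 1) δ) 1 = δ := fun δ => Function.update_self _ _ _
      have hbK : ∀ (δ : WithTop (valueGroup K)) i,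
          fieldVar s (Function.update b (.Γ, 1) δ) i = fieldVar s b i := fun δ i =>
        Function.update_of_ne (by simp) _ _
      have hbx : ∀ (δ : WithTop (valueGroup K)) (i : Fin m),
          fieldVar s (Function.update b (.Γ, 1) δ) (i + 1) = x i := fun δ i =>
        (hbK δ _).trans (dif_pos i.2)
      have hbm : ∀ δ : WithTop (valueGroup K),
          fieldVar s (Function.update b (.Γ, 1) δ) 0 = -1 := fun δ => hbK δ 0
      have hmin := hK.eq_minPos_iff.2 rfl
      have hred : ∀ (δ : WithTop (valueGroup K)) (i : Fin m),
          Reduces (s.ext hK.minPos : PadicAlgCl p)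
            (fieldVar s (Function.update b (.Γ, 1) δ) (i + 1) : PadicAlgCl p) (y i) :=
        fun δ i => (hbx δ i).symm ▸ hx i
      refine hsimp.2 ⟨(hb0 δ).symm ▸ hmin.1, ?_, ?_, fun i hi => ?_, ?_⟩
      · rw [hb0 δ, hb1 δ]; exact hmin.2 δ
      · rw [hbm δ]; simp
      · exact (hred δ ⟨i, hi⟩).norm_le_one hn hπ
      · exact (realize_liftFormula hK s (hb0 δ) (hred δ) (hbm δ) hφ).2 hy

end PadicExt

/-! ### The translation of terms and quantifier-free formulas on Gödel numbers. -/

namespace Lval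

open FirstOrder.Language
open Nat (pair unpair pair_eq_pair left_le_pair right_le_pair add_le_pair unpair_pair)

section Codes

theorem getD_map_range (f : ℕ → ℕ) {a c : ℕ} (h : a < c) :
    ((List.range c).map f).getD a 0 = f a := by
  simp [List.getD, h]

theorem lt_of_getD_map_range_ne_zero {f : ℕ → ℕ} {a c : ℕ}
    (h : ((List.range c).map f).getD a 0 ≠ 0) : a < c := by
  by_contra hac
  exact h (by simp [List.getD, hac])

open Classical in
/-- `0` if `c` is not the code of a term in `m` variables, and otherwise the successor of the code
of its translation. -/
noncomputable def termValue (m c : ℕ) : ℕ :=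
  if h : ∃ τ : LtP.Term (Empty ⊕ Fin m), LtP.termCode τ = c then (liftTerm h.choose).code + 1 else 0

theorem termValue_termCode {m : ℕ} (τ : LtP.Term (Empty ⊕ Fin m)) :
    termValue m (LtP.termCode τ) = (liftTerm τ).code + 1 := by
  have h : ∃ σ : LtP.Term (Empty ⊕ Fin m), LtP.termCode σ = LtP.termCode τ := ⟨τ, rfl⟩
  rw [termValue, dif_pos h, LtP.termCode_inj h.choose_spec]

theorem exists_of_termValue_ne_zero {m c : ℕ} (h : termValue m c ≠ 0) :
    ∃ τ : LtP.Term (Empty ⊕ Fin m), LtP.termCode τ = c := by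
  by_contra h'
  exact h (dif_neg h')

open Classical in
/-- `0` if `c` is not the code of a quantifier-free formula in `m` variables, and otherwise the
successor of the code of its translation. -/
noncomputable def formulaValue (p m c : ℕ) : ℕ :=
  if h : ∃ φ : LtP.BoundedFormula Empty m, φ.IsQF ∧ LtP.code φ = c then
    (liftFormula p h.choose).code + 1 else 0

theorem formulaValue_code {p m : ℕ} {φ : LtP.BoundedFormula Empty m} (hφ : φ.IsQF) :
    formulaValue p m (LtP.code φ) = (liftFormula p φ).code + 1 := by
  have h : ∃ ψ : LtP.BoundedFormula Empty m, ψ.IsQF ∧ LtP.code ψ = LtP.code φ := ⟨φ, hφ, rfl⟩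
  rw [formulaValue, dif_pos h, LtP.code_inj h.choose_spec.2]

theorem exists_of_formulaValue_ne_zero {p m c : ℕ} (h : formulaValue p m c ≠ 0) :
    ∃ φ : LtP.BoundedFormula Empty m, φ.IsQF ∧ LtP.code φ = c := by
  by_contra h'
  exact h (dif_neg h')

/-- The code of an application of a binary function symbol. -/
def appCode (f a b : ℕ) : ℕ := pair 1 (pair f (pair a (pair b 0 + 1) + 1))

/-- The first argument of an application. -/
def appFst (c : ℕ) : ℕ := (c.unpair.2.unpair.2 - 1).unpair.1

/-- The second argument of an application. -/
def appSnd (c : ℕ) : ℕ := ((c.unpair.2.unpair.2 - 1).unpair.2 - 1).unpair.1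

theorem appFst_appCode (f a b : ℕ) : appFst (appCode f a b) = a := by simp [appFst, appCode]

theorem appSnd_appCode (f a b : ℕ) : appSnd (appCode f a b) = b := by simp [appSnd, appCode]

/-- Codes of subterms are smaller, so their translations are found in the list of previous values of
a course-of-values recursion. -/
theorem lt_appCode_left (f a b : ℕ) : a < appCode f a b :=
  calc a ≤ pair a (pair b 0 + 1) := left_le_pair _ _
    _ < pair a (pair b 0 + 1) + 1 := Nat.lt_succ_self _
    _ ≤ pair f (pair a (pair b 0 + 1) + 1) := right_le_pair _ _
    _ ≤ _ := right_le_pair _ _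

theorem lt_appCode_right (f a b : ℕ) : b < appCode f a b :=
  calc b ≤ pair b 0 := left_le_pair _ _
    _ < pair b 0 + 1 := Nat.lt_succ_self _
    _ ≤ pair a (pair b 0 + 1) := right_le_pair _ _
    _ ≤ pair a (pair b 0 + 1) + 1 := Nat.le_succ _
    _ ≤ pair f (pair a (pair b 0 + 1) + 1) := right_le_pair _ _
    _ ≤ _ := right_le_pair _ _

/-- A list is encoded by `0` if empty and by `pair a l + 1` for head `a` and tail code `l`; this
accounts for the shape of `appCode` and for the predecessors in `appFst` and `appSnd`. -/
theorem termCode_add {m : ℕ} (ts : Fin 2 → LtP.Term (Empty ⊕ Fin m)) :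
    LtP.termCode (.func (L := LtP) LtFunc.add ts) =
      appCode 3 (LtP.termCode (ts 0)) (LtP.termCode (ts 1)) := by
  simp [LtP.termCode, LtP.funcCode, appCode]

theorem termCode_mul {m : ℕ} (ts : Fin 2 → LtP.Term (Empty ⊕ Fin m)) :
    LtP.termCode (.func (L := LtP) LtFunc.mul ts) =
      appCode 4 (LtP.termCode (ts 0)) (LtP.termCode (ts 1)) := by
  simp [LtP.termCode, LtP.funcCode, appCode]

/-- The recursion step for `termValue`, `l` being the list of the previous values. -/
def termStep (m : ℕ) (l : List ℕ) : ℕ :=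
  -- The length of the list is the input itself. Each test rebuilds the input from its decoded
  -- parts, so numbers of the wrong shape are rejected.
  if l.length = pair 0 l.length.unpair.2 ∧ l.length.unpair.2 < m then
    pair 0 (pair 0 (l.length.unpair.2 + 1)) + 1
  else if l.length = pair 1 (pair 0 0) then pair 1 0 + 1
  else if l.length = pair 1 (pair 1 0) then pair 2 0 + 1
  -- The output is the code of `s(γ_0)`, shifted by one.
  else if l.length = pair 1 (pair 2 0) then pair 14 (pair 0 (pair 1 0)) + 1
  else if l.length = appCode 3 (appFst l.length) (appSnd l.length) ∧
      l.getD (appFst l.length) 0 ≠ 0 ∧ l.getD (appSnd l.length) 0 ≠ 0 then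
    pair 3 (pair (l.getD (appFst l.length) 0 - 1) (l.getD (appSnd l.length) 0 - 1)) + 1
  else if l.length = appCode 4 (appFst l.length) (appSnd l.length) ∧
      l.getD (appFst l.length) 0 ≠ 0 ∧ l.getD (appSnd l.length) 0 ≠ 0 then
    pair 4 (pair (l.getD (appFst l.length) 0 - 1) (l.getD (appSnd l.length) 0 - 1)) + 1
  else 0

theorem exists_of_getD_termValue {m a c : ℕ}
    (h : ((List.range c).map (termValue m)).getD a 0 ≠ 0) :
    ∃ τ : LtP.Term (Empty ⊕ Fin m), LtP.termCode τ = a := by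
  have hac := lt_of_getD_map_range_ne_zero h
  rw [getD_map_range _ hac] at h
  exact exists_of_termValue_ne_zero h

/-- The recursion equation that makes `termValue`, defined by choice, computable. For codes of terms
one compares with the definition of the translation; for other numbers, a successful branch would
produce a term with that code. -/
theorem termStep_map_range (m c : ℕ) :
    termStep m ((List.range c).map (termValue m)) = termValue m c := by
  by_cases h : ∃ τ : LtP.Term (Empty ⊕ Fin m), LtP.termCode τ = c
  · obtain ⟨τ, rfl⟩ := h
    rw [termValue_termCode]
    rcases τ with (e | i) | ⟨f, ts⟩
    · exact e.elim
    · simp [termStep, LtP.termCode, liftTerm, Term.code, Srt.code]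
    · cases f
      · simp [termStep, LtP.termCode, LtP.funcCode, liftTerm, Term.code, pair_eq_pair]
      · simp [termStep, LtP.termCode, LtP.funcCode, liftTerm, Term.code, pair_eq_pair]
      · simp [termStep, LtP.termCode, LtP.funcCode, liftTerm, Term.code, pair_eq_pair, Srt.code]
      · have h1 := getD_map_range (termValue m)
          (lt_appCode_left 3 (LtP.termCode (ts 0)) (LtP.termCode (ts 1)))
        have h2 := getD_map_range (termValue m)
          (lt_appCode_right 3 (LtP.termCode (ts 0)) (LtP.termCode (ts 1)))
        rw [termCode_add, termStep]
        simp only [List.length_map, List.length_range, appFst_appCode, appSnd_appCode, h1, h2,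
          termValue_termCode]
        simp [appCode, pair_eq_pair, liftTerm, Term.code]
      · have h1 := getD_map_range (termValue m)
          (lt_appCode_left 4 (LtP.termCode (ts 0)) (LtP.termCode (ts 1)))
        have h2 := getD_map_range (termValue m)
          (lt_appCode_right 4 (LtP.termCode (ts 0)) (LtP.termCode (ts 1)))
        rw [termCode_mul, termStep]
        simp only [List.length_map, List.length_range, appFst_appCode, appSnd_appCode, h1, h2,
          termValue_termCode]
        simp [appCode, pair_eq_pair, liftTerm, Term.code]
  · rw [termValue, dif_neg h, termStep]
    simp only [List.length_map, List.length_range]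
    rw [if_neg, if_neg, if_neg, if_neg, if_neg, if_neg]
    · rintro ⟨hc, ha, hb⟩
      obtain ⟨τ, hτ⟩ := exists_of_getD_termValue ha
      obtain ⟨σ, hσ⟩ := exists_of_getD_termValue hb
      exact h ⟨.func (L := LtP) LtFunc.mul ![τ, σ], by
        rw [termCode_mul, hc]; simp [hτ, hσ]⟩
    · rintro ⟨hc, ha, hb⟩
      obtain ⟨τ, hτ⟩ := exists_of_getD_termValue ha
      obtain ⟨σ, hσ⟩ := exists_of_getD_termValue hb
      exact h ⟨.func (L := LtP) LtFunc.add ![τ, σ], by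
        rw [termCode_add, hc]; simp [hτ, hσ]⟩
    · rintro rfl
      exact h ⟨.func (L := LtP) LtFunc.t ![], by simp [LtP.termCode, LtP.funcCode]⟩
    · rintro rfl
      exact h ⟨.func (L := LtP) LtFunc.one ![], by simp [LtP.termCode, LtP.funcCode]⟩
    · rintro rfl
      exact h ⟨.func (L := LtP) LtFunc.zero ![], by simp [LtP.termCode, LtP.funcCode]⟩
    · rintro ⟨hc, hi⟩
      exact h ⟨.var (Sum.inr ⟨_, hi⟩), by rw [LtP.termCode]; exact hc.symm⟩

/-- The code of `Formula.congr p a b` in terms of the codes of `a` and `b`. -/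
def congrCode (p x y : ℕ) : ℕ :=
  pair 3 (pair (pair 2 (pair (pair 12 (pair 3 (pair x (pair 4 (pair (pair 0 (pair 0 0)) y)))))
    (pair 12 (Term.numeral p).code))) (pair 0 0))

theorem code_congr (p : ℕ) (a b : Term .K) :
    (Formula.congr p a b).code = congrCode p a.code b.code := rfl

/-- The recursion step for `formulaValue`, `l` being the list of the previous values. -/
noncomputable def formulaStep (p m : ℕ) (l : List ℕ) : ℕ :=
  if l.length = pair 0 0 then pair 0 0 + 1
  else if l.length = pair 1 (pair l.length.unpair.2.unpair.1 l.length.unpair.2.unpair.2) ∧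
      termValue m l.length.unpair.2.unpair.1 ≠ 0 ∧ termValue m l.length.unpair.2.unpair.2 ≠ 0 then
    congrCode p (termValue m l.length.unpair.2.unpair.1 - 1)
      (termValue m l.length.unpair.2.unpair.2 - 1) + 1
  else if l.length = pair 2 (pair (l.length.unpair.2 - 1).unpair.1 0 + 1) ∧
      termValue m (l.length.unpair.2 - 1).unpair.1 ≠ 0 then
    congrCode p (termValue m (l.length.unpair.2 - 1).unpair.1 - 1)
      (pair 14 (pair 12 (termValue m (l.length.unpair.2 - 1).unpair.1 - 1))) + 1
  else if l.length = pair 3 (pair l.length.unpair.2.unpair.1 l.length.unpair.2.unpair.2) ∧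
      l.getD l.length.unpair.2.unpair.1 0 ≠ 0 ∧ l.getD l.length.unpair.2.unpair.2 0 ≠ 0 then
    pair 3 (pair (l.getD l.length.unpair.2.unpair.1 0 - 1)
      (l.getD l.length.unpair.2.unpair.2 0 - 1)) + 1
  else 0

theorem lt_pair_right {k : ℕ} (hk : k ≠ 0) (b : ℕ) : b < pair k b := by
  have := add_le_pair k b
  omega

theorem exists_of_getD_formulaValue {p m a c : ℕ}
    (h : ((List.range c).map (formulaValue p m)).getD a 0 ≠ 0) :
    ∃ φ : LtP.BoundedFormula Empty m, φ.IsQF ∧ LtP.code φ = a := by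
  have hac := lt_of_getD_map_range_ne_zero h
  rw [getD_map_range _ hac] at h
  exact exists_of_formulaValue_ne_zero h

theorem code_boundedFormula_P {m : ℕ} (τ : LtP.Term (Empty ⊕ Fin m)) :
    LtP.code (Relations.boundedFormula (L := LtP) LtRel.P ![τ]) =
      pair 2 (pair (LtP.termCode τ) 0 + 1) := by
  have : LtP.code (Relations.boundedFormula (L := LtP) LtRel.P ![τ]) =
    pair 2 (Encodable.encode (List.ofFn fun i => LtP.termCode (![τ] i))) := rfl
  rw [this]
  simp

/-- As for terms: only implications recurse, while atoms call `termValue`. -/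
theorem formulaStep_map_range (p m c : ℕ) :
    formulaStep p m ((List.range c).map (formulaValue p m)) = formulaValue p m c := by
  by_cases h : ∃ φ : LtP.BoundedFormula Empty m, φ.IsQF ∧ LtP.code φ = c
  · obtain ⟨φ, hφ, rfl⟩ := h
    rw [formulaValue_code hφ]
    cases hφ with
    | falsum => simp [formulaStep, LtP.code, liftFormula, Formula.code]
    | of_isAtomic h =>
      cases h with
      | equal τ σ =>
        simp [formulaStep, Term.bdEqual, LtP.code, liftFormula, code_congr, termValue_termCode,
          pair_eq_pair]
      | rel R ts =>
        cases R
        simp [formulaStep, Relations.boundedFormula, LtP.code, liftFormula, code_congr,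
          termValue_termCode, pair_eq_pair, Term.code]
    | @imp φ ψ hφ hψ =>
      have h1 := getD_map_range (formulaValue p m) (a := LtP.code φ) (c := LtP.code (φ.imp ψ))
        ((left_le_pair _ _).trans_lt (lt_pair_right (by simp) _))
      have h2 := getD_map_range (formulaValue p m) (a := LtP.code ψ) (c := LtP.code (φ.imp ψ))
        ((right_le_pair _ _).trans_lt (lt_pair_right (by simp) _))
      rw [LtP.code] at h1 h2 ⊢
      rw [formulaStep]
      simp only [List.length_map, List.length_range, unpair_pair, h1, h2, formulaValue_code hφ,
        formulaValue_code hψ]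
      simp [pair_eq_pair, liftFormula, Formula.code]
  · rw [formulaValue, dif_neg h, formulaStep]
    simp only [List.length_map, List.length_range]
    rw [if_neg, if_neg, if_neg, if_neg]
    · rintro ⟨hc, ha, hb⟩
      obtain ⟨φ, hφ, hφc⟩ := exists_of_getD_formulaValue ha
      obtain ⟨ψ, hψ, hψc⟩ := exists_of_getD_formulaValue hb
      exact h ⟨φ.imp ψ, .imp hφ hψ, by rw [LtP.code, hφc, hψc]; exact hc.symm⟩
    · rintro ⟨hc, ha⟩
      obtain ⟨τ, hτ⟩ := exists_of_termValue_ne_zero ha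
      refine h ⟨Relations.boundedFormula (L := LtP) LtRel.P ![τ], .of_isAtomic (.rel _ _), ?_⟩
      rw [code_boundedFormula_P, hτ]
      exact hc.symm
    · rintro ⟨hc, ha, hb⟩
      obtain ⟨τ, hτ⟩ := exists_of_termValue_ne_zero ha
      obtain ⟨σ, hσ⟩ := exists_of_termValue_ne_zero hb
      exact h ⟨τ.bdEqual σ, .of_isAtomic (.equal _ _), by
        rw [Term.bdEqual, LtP.code, hτ, hσ]; exact hc.symm⟩
    · rintro rfl
      exact h ⟨.falsum, .falsum, rfl⟩

end Codes

end Lval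

/-! ### Primitive recursiveness of the translation. -/

namespace Lval

open FirstOrder.Language
open Nat (pair unpair)

section Primrec

variable {α : Type*} [Primcodable α]

theorem primrec_pair {f g : α → ℕ} (hf : Primrec f) (hg : Primrec g) :
    Primrec fun a => pair (f a) (g a) :=
  Primrec₂.natPair.comp hf hg

theorem primrec_unpair_fst {f : α → ℕ} (hf : Primrec f) : Primrec fun a => (f a).unpair.1 :=
  Primrec.fst.comp (Primrec.unpair.comp hf)

theorem primrec_unpair_snd {f : α → ℕ} (hf : Primrec f) : Primrec fun a => (f a).unpair.2 :=
  Primrec.snd.comp (Primrec.unpair.comp hf)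

theorem primrec_succ {f : α → ℕ} (hf : Primrec f) : Primrec fun a => f a + 1 :=
  Primrec.succ.comp hf

theorem primrec_pred {f : α → ℕ} (hf : Primrec f) : Primrec fun a => f a - 1 :=
  Primrec.pred.comp hf

theorem primrec_getD {f : α → List ℕ} {g : α → ℕ} (hf : Primrec f) (hg : Primrec g) :
    Primrec fun a => (f a).getD (g a) 0 :=
  (Primrec.list_getD 0).comp hf hg

theorem primrecPred_eq {f g : α → ℕ} (hf : Primrec f) (hg : Primrec g) :
    PrimrecPred fun a => f a = g a :=
  Primrec.eq.comp hf hg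

theorem primrecPred_ne_zero {f : α → ℕ} (hf : Primrec f) : PrimrecPred fun a => f a ≠ 0 :=
  (primrecPred_eq hf (Primrec.const 0)).not

theorem primrec_appCode (k : ℕ) {f g : α → ℕ} (hf : Primrec f) (hg : Primrec g) :
    Primrec fun a => appCode k (f a) (g a) :=
  primrec_pair (Primrec.const 1) (primrec_pair (Primrec.const k)
    (primrec_succ (primrec_pair hf (primrec_succ (primrec_pair hg (Primrec.const 0))))))

theorem primrec_appFst {f : α → ℕ} (hf : Primrec f) : Primrec fun a => appFst (f a) :=
  primrec_unpair_fst (primrec_pred (primrec_unpair_snd (primrec_unpair_snd hf)))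

theorem primrec_appSnd {f : α → ℕ} (hf : Primrec f) : Primrec fun a => appSnd (f a) :=
  primrec_unpair_fst (primrec_pred (primrec_unpair_snd (primrec_pred
    (primrec_unpair_snd (primrec_unpair_snd hf)))))

theorem primrec_congrCode (p : ℕ) {f g : α → ℕ} (hf : Primrec f) (hg : Primrec g) :
    Primrec fun a => congrCode p (f a) (g a) :=
  primrec_pair (.const _) (primrec_pair (primrec_pair (.const _) (primrec_pair
    (primrec_pair (.const _) (primrec_pair (.const _) (primrec_pair hf
      (primrec_pair (.const _) (primrec_pair (.const _) hg))))) (.const _))) (.const _))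

theorem primrec_termStep : Primrec₂ termStep := by
  have hl : Primrec fun q : ℕ × List ℕ => q.2.length := Primrec.list_length.comp Primrec.snd
  have hr := primrec_unpair_snd hl
  have hF := primrec_appFst hl
  have hS := primrec_appSnd hl
  have hF' := primrec_getD Primrec.snd hF
  have hS' := primrec_getD Primrec.snd hS
  have hne := (primrecPred_ne_zero hF').and (primrecPred_ne_zero hS')
  have happ := fun k => (primrecPred_eq hl (primrec_appCode k hF hS)).and hne
  have hout := fun k : ℕ => primrec_succ (primrec_pair (Primrec.const k)
    (primrec_pair (primrec_pred hF') (primrec_pred hS')))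
  refine Primrec.ite ((primrecPred_eq hl (primrec_pair (.const 0) hr)).and
    (Primrec.nat_lt.comp hr Primrec.fst)) (primrec_succ (primrec_pair (.const _)
      (primrec_pair (.const _) (primrec_succ hr)))) ?_
  refine Primrec.ite (primrecPred_eq hl (.const _)) (.const _) ?_
  refine Primrec.ite (primrecPred_eq hl (.const _)) (.const _) ?_
  refine Primrec.ite (primrecPred_eq hl (.const _)) (.const _) ?_
  refine Primrec.ite (happ 3) (hout 3) ?_
  exact Primrec.ite (happ 4) (hout 4) (.const _)

theorem primrec_termValue : Primrec₂ termValue :=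
  Primrec.nat_strong_rec termValue (g := fun m l => some (termStep m l))
    (Primrec.option_some.comp₂ primrec_termStep) fun m c => by rw [termStep_map_range]

theorem primrec_formulaStep (p : ℕ) : Primrec₂ (formulaStep p) := by
  have hl : Primrec fun q : ℕ × List ℕ => q.2.length := Primrec.list_length.comp Primrec.snd
  have h1 := primrec_unpair_fst (primrec_unpair_snd hl)
  have h2 := primrec_unpair_snd (primrec_unpair_snd hl)
  have h3 := primrec_unpair_fst (primrec_pred (primrec_unpair_snd hl))
  have t1 := primrec_termValue.comp Primrec.fst h1
  have t2 := primrec_termValue.comp Primrec.fst h2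
  have t3 := primrec_termValue.comp Primrec.fst h3
  have l1 := primrec_getD Primrec.snd h1
  have l2 := primrec_getD Primrec.snd h2
  refine Primrec.ite (primrecPred_eq hl (.const _)) (.const _) ?_
  refine Primrec.ite ((primrecPred_eq hl (primrec_pair (.const _) (primrec_pair h1 h2))).and
    ((primrecPred_ne_zero t1).and (primrecPred_ne_zero t2)))
    (primrec_succ (primrec_congrCode p (primrec_pred t1) (primrec_pred t2))) ?_
  refine Primrec.ite ((primrecPred_eq hl (primrec_pair (.const _)
    (primrec_succ (primrec_pair h3 (.const _))))).and (primrecPred_ne_zero t3))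
    (primrec_succ (primrec_congrCode p (primrec_pred t3) (primrec_pair (.const _)
      (primrec_pair (.const _) (primrec_pred t3))))) ?_
  exact Primrec.ite ((primrecPred_eq hl (primrec_pair (.const _) (primrec_pair h1 h2))).and
    ((primrecPred_ne_zero l1).and (primrecPred_ne_zero l2)))
    (primrec_succ (primrec_pair (.const _) (primrec_pair (primrec_pred l1) (primrec_pred l2))))
    (.const _)

theorem primrec_formulaValue (p : ℕ) : Primrec₂ (formulaValue p) :=
  Primrec.nat_strong_rec (formulaValue p) (g := fun m l => some (formulaStep p m l))
    (Primrec.option_some.comp₂ (primrec_formulaStep p)) fun m c => by rw [formulaStep_map_range]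

/-- The code of a conjunction. -/
def conjCode (x y : ℕ) : ℕ :=
  pair 3 (pair (pair 3 (pair x (pair 3 (pair y (pair 0 0))))) (pair 0 0))

theorem code_conj (φ ψ : Formula) : (φ.conj ψ).code = conjCode φ.code ψ.code := rfl

theorem primrec_conjCode {f g : α → ℕ} (hf : Primrec f) (hg : Primrec g) :
    Primrec fun a => conjCode (f a) (g a) :=
  primrec_pair (.const _) (primrec_pair (primrec_pair (.const _) (primrec_pair hf
    (primrec_pair (.const _) (primrec_pair hg (.const _))))) (.const _))

/-- The code of `φ.integral m` in terms of the code `x` of `φ`. -/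
def integralCode (x m : ℕ) : ℕ :=
  m.rec x fun k y => conjCode (pair 3 (pair (pair 2 (pair (pair 12 (pair 0 (pair 0 (k + 1))))
    (pair 5 0))) (pair 0 0))) y

theorem code_integral (φ : Formula) (m : ℕ) : (φ.integral m).code = integralCode φ.code m := by
  induction m with
  | zero => rfl
  | succ m ih => rw [Formula.integral, code_conj, ih]; rfl

theorem primrec_integralCode : Primrec₂ integralCode := by
  have hk : Primrec fun q : ℕ × ℕ × ℕ => q.2.1 + 1 :=
    primrec_succ (Primrec.fst.comp Primrec.snd)
  exact Primrec.nat_rec (f := fun x : ℕ => x) Primrec.id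
    (g := fun _ q => conjCode (pair 3 (pair (pair 2 (pair (pair 12 (pair 0 (pair 0 (q.1 + 1))))
      (pair 5 0))) (pair 0 0))) q.2)
    (primrec_conjCode (primrec_pair (.const _) (primrec_pair (primrec_pair (.const _)
      (primrec_pair (primrec_pair (.const _) (primrec_pair (.const _) (primrec_pair (.const _) hk)))
        (.const _))) (.const _))) (Primrec.snd.comp Primrec.snd))

/-- The code of `φ.exK j` in terms of the code `x` of `φ`. -/
def exKCode (x j : ℕ) : ℕ := j.rec x fun k y => pair 5 (pair (pair 0 k) y)

theorem code_exK (φ : Formula) (j : ℕ) : (φ.exK j).code = exKCode φ.code j := by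
  induction j with
  | zero => rfl
  | succ j ih => rw [Formula.exK, Formula.code, ih]; rfl

theorem primrec_exKCode : Primrec₂ exKCode :=
  Primrec.nat_rec (f := fun x : ℕ => x) Primrec.id
    (g := fun _ q => pair 5 (pair (pair 0 q.1) q.2))
    (primrec_pair (.const _) (primrec_pair (primrec_pair (.const _)
      (Primrec.fst.comp Primrec.snd)) (Primrec.snd.comp Primrec.snd)))

/-- The code of `φ.setup` in terms of the code `x` of `φ`. -/
def setupCode (x : ℕ) : ℕ :=
  conjCode (Formula.lt .zeroΓ (.var .Γ 0)).code (conjCode (Formula.imp (.lt .zeroΓ (.var .Γ 1))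
    (Formula.neg (.lt (.var .Γ 1) (.var .Γ 0)))).code
      (conjCode (Formula.eq (.addK (.var .K 0) .oneK) .zeroK).code x))

theorem code_setup (φ : Formula) : φ.setup.code = setupCode φ.code := rfl

theorem primrec_setupCode {f : α → ℕ} (hf : Primrec f) : Primrec fun a => setupCode (f a) :=
  primrec_conjCode (.const _) (primrec_conjCode (.const _) (primrec_conjCode (.const _) hf))

/-- The code of `φ.closure m` in terms of the code `x` of `φ`. -/
def closureCode (m x : ℕ) : ℕ :=
  pair 5 (pair (pair 1 0) (exKCode (pair 4 (pair (pair 1 1) (setupCode (integralCode x m))))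
    (m + 1)))

theorem code_closure (m : ℕ) (φ : Formula) : (φ.closure m).code = closureCode m φ.code := by
  rw [Formula.closure, Formula.code, code_exK, Formula.code, code_setup, code_integral]
  rfl

theorem primrec_closureCode {f g : α → ℕ} (hf : Primrec f) (hg : Primrec g) :
    Primrec fun a => closureCode (f a) (g a) :=
  primrec_pair (.const _) (primrec_pair (.const _) (primrec_exKCode.comp
    (primrec_pair (.const _) (primrec_pair (.const _) (primrec_setupCode
      (primrec_integralCode.comp hg hf)))) (primrec_succ hf)))

end Primrec

/-! ### Existential prefixes on codes, and the reduction. -/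

section Existential

/-- The code of `φ.ex` in terms of the code of `φ`. -/
def exCode (d : ℕ) : ℕ := pair 3 (pair (pair 4 (pair 3 (pair d (pair 0 0)))) (pair 0 0))

/-- Left inverse of `exCode`. -/
def exBody (c : ℕ) : ℕ := c.unpair.2.unpair.1.unpair.2.unpair.2.unpair.1

theorem exBody_exCode : Function.LeftInverse exBody exCode := fun d => by simp [exBody, exCode]

theorem lt_exCode (d : ℕ) : d < exCode d :=
  calc d ≤ pair d (pair 0 0) := Nat.left_le_pair _ _
    _ < pair 3 (pair d (pair 0 0)) := lt_pair_right (by simp) _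
    _ ≤ pair 4 _ := Nat.right_le_pair _ _
    _ ≤ pair _ (pair 0 0) := Nat.left_le_pair _ _
    _ ≤ pair 3 _ := Nat.right_le_pair _ _

/-- Bounds the length of an existential prefix by the code, so that `exDepth` can be a bounded
search. -/
theorem le_iterate_exCode (m d : ℕ) : m ≤ exCode^[m] d := by
  induction m with
  | zero => exact Nat.zero_le _
  | succ m ih =>
    rw [Function.iterate_succ_apply']
    exact (Nat.succ_le_succ ih).trans (lt_exCode _)

theorem code_exs {m : ℕ} (φ : LtP.BoundedFormula Empty m) :
    LtP.code φ.exs = exCode^[m] (LtP.code φ) := by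
  induction m with
  | zero => rfl
  | succ m ih => exact (ih φ.ex).trans rfl

theorem exists_isQF_exs_eq {n : ℕ} {φ : LtP.BoundedFormula Empty n} (hφ : φ.IsExistential) :
    ∃ (m : ℕ) (ψ : LtP.BoundedFormula Empty m), ψ.IsQF ∧ φ.exs = ψ.exs := by
  induction hφ with
  | of_isQF h => exact ⟨_, _, h, rfl⟩
  | ex _ ih => exact ih

theorem isExistential_exs {n : ℕ} {φ : LtP.BoundedFormula Empty n} (hφ : φ.IsExistential) :
    BoundedFormula.IsExistential φ.exs := by
  induction n with
  | zero => exact hφ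
  | succ n ih => exact ih hφ.ex

/-- `∃` is `¬∀¬`, so `exCode d` is an implication whose premise carries the tag of `∀`, which no
quantifier-free formula has. Hence the prefix of an existential sentence can be read off from its
code. -/
theorem code_ne_exCode {m d : ℕ} {φ : LtP.BoundedFormula Empty m} (hφ : φ.IsQF) :
    LtP.code φ ≠ exCode d := by
  intro h
  rcases hφ with _ | h' | ⟨h1, h2⟩
  · simp [LtP.code, exCode, Nat.pair_eq_pair] at h
  · cases h' <;>
      simp [Term.bdEqual, Relations.boundedFormula, LtP.code, exCode, Nat.pair_eq_pair] at h
  · simp only [LtP.code, exCode, Nat.pair_eq_pair, true_and] at h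
    rcases h1 with _ | h' | ⟨h1, h2⟩
    · simp [LtP.code, Nat.pair_eq_pair] at h
    · cases h' <;>
        simp [Term.bdEqual, Relations.boundedFormula, LtP.code, Nat.pair_eq_pair] at h
    · simp [LtP.code, Nat.pair_eq_pair] at h

/-- The number of leading existential quantifiers of the formula with code `c`. -/
def exDepth (c : ℕ) : ℕ := Nat.findGreatest (fun k => c = exCode^[k] (exBody^[k] c)) c

theorem iterate_exCode_exDepth (c : ℕ) : exCode^[exDepth c] (exBody^[exDepth c] c) = c :=
  (Nat.findGreatest_spec (P := fun k => c = exCode^[k] (exBody^[k] c)) (Nat.zero_le c) rfl).symm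

theorem exDepth_code_exs {m : ℕ} {φ : LtP.BoundedFormula Empty m} (hφ : φ.IsQF) :
    exDepth (LtP.code φ.exs) = m := by
  rw [exDepth, Nat.findGreatest_eq_iff]
  rw [code_exs]
  refine ⟨le_iterate_exCode _ _, fun _ => ?_, fun k hk _ h => ?_⟩
  · rw [exBody_exCode.iterate m]
  -- If more than `m` quantifiers could be stripped, cancelling the first `m` would leave a
  -- quantifier-free code in the range of `exCode`.
  · obtain ⟨j, rfl⟩ := Nat.exists_eq_add_of_lt hk
    rw [show m + j + 1 = m + (j + 1) by ring, Function.iterate_add_apply,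
      Function.iterate_succ_apply'] at h
    exact code_ne_exCode hφ (exBody_exCode.injective.iterate m h)

/-- The reduction on codes. -/
noncomputable def reduction (p c : ℕ) : ℕ :=
  if formulaValue p (exDepth c) (exBody^[exDepth c] c) = 0 then pair 0 0
  else closureCode (exDepth c) (formulaValue p (exDepth c) (exBody^[exDepth c] c) - 1)

theorem reduction_code_exs (p : ℕ) {m : ℕ} {φ : LtP.BoundedFormula Empty m} (hφ : φ.IsQF) :
    reduction p (LtP.code φ.exs) = ((liftFormula p φ).closure m).code := by
  have h : exBody^[m] (LtP.code φ.exs) = LtP.code φ := by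
    rw [code_exs, exBody_exCode.iterate m]
  rw [reduction, exDepth_code_exs hφ, h, formulaValue_code hφ, if_neg (Nat.succ_ne_zero _),
    code_closure, Nat.add_sub_cancel]

/-- Guards the converse direction: numbers that do not code existential sentences are sent to `⊥`.
-/
theorem reduction_eq_or (p c : ℕ) :
    reduction p c = Formula.falsum.code ∨
      ∃ (m : ℕ) (φ : LtP.BoundedFormula Empty m), φ.IsQF ∧ LtP.code φ.exs = c := by
  by_cases h : formulaValue p (exDepth c) (exBody^[exDepth c] c) = 0
  · left
    rw [reduction, if_pos h]
    rfl
  · right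
    obtain ⟨φ, hφ, hc⟩ := exists_of_formulaValue_ne_zero h
    exact ⟨_, φ, hφ, by rw [code_exs, hc, iterate_exCode_exDepth]⟩

theorem primrec_reduction (p : ℕ) : Primrec (reduction p) := by
  have hB : Primrec exBody := primrec_unpair_fst (primrec_unpair_snd (primrec_unpair_snd
    (primrec_unpair_fst (primrec_unpair_snd Primrec.id))))
  have hE : Primrec exCode := primrec_pair (.const _) (primrec_pair (primrec_pair (.const _)
    (primrec_pair (.const _) (primrec_pair Primrec.id (.const _)))) (.const _))
  have hBi : Primrec₂ fun c k : ℕ => exBody^[k] c :=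
    Primrec.nat_iterate Primrec.snd Primrec.fst (hB.comp Primrec.snd)
  have hEi : Primrec₂ fun c k : ℕ => exCode^[k] c :=
    Primrec.nat_iterate Primrec.snd Primrec.fst (hE.comp Primrec.snd)
  have hD : Primrec exDepth := Primrec.nat_findGreatest Primrec.id
    (primrecPred_eq Primrec.fst (hEi.comp hBi Primrec.snd))
  have hv := (primrec_formulaValue p).comp hD (hBi.comp Primrec.id hD)
  exact Primrec.ite (primrecPred_eq hv (.const 0)) (.const _)
    (primrec_closureCode hD (primrec_pred hv))

end Existential

end Lval

/-! ### From many-one to Turing reducibility, and the passage from degrees to fields. -/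

theorem turingReducible_charFun {A B : Set ℕ} {f : ℕ → ℕ} (hf : Primrec f)
    (h : ∀ c, c ∈ A ↔ f c ∈ B) : TuringReducible (charFun A) (charFun B) := by
  classical
  have h1 : Nat.RecursiveIn {charFun B} (f : ℕ →. ℕ) :=
    RecursiveIn.iff_nat.1 (Partrec.recursiveIn hf.to_comp)
  have h2 := Nat.RecursiveIn.comp (Nat.RecursiveIn.oracle (charFun B) (Set.mem_singleton _)) h1
  refine RecursiveIn.iff_nat.2 (h2.of_eq fun c => ?_)
  refine (Part.bind_some (f c) (charFun B)).trans ?_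
  simp [charFun, Set.indicator_apply, h]

open PadicExt Lval in
theorem reduction_mem_iff (p : ℕ) [Fact p.Prime] (s : (K : TotRam p) → CrossSection K.1) (c : ℕ) :
    c ∈ LtP.code '' asymptoticExistentialTheory p ↔
      reduction p c ∈ Lval.Formula.code '' asymptoticExistsForallTheory s := by
  have hfin : Filter.Tendsto (fun K : TotRam p => Module.finrank ℚ_[p] K.1) Filter.cofinite
      Filter.cofinite :=
    Filter.Tendsto.cofinite_of_finite_preimage_singleton fun n => finite_totRam_finrank_eq n
  have hiff : ∀ {m : ℕ} {φ : LtP.BoundedFormula Empty m}, φ.IsQF →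
      ((∀ᶠ K : TotRam p in Filter.cofinite,
        (padicStr K.1 (s K)).Models ((liftFormula p φ).closure m)) ↔
          ∀ᶠ n : ℕ in Filter.cofinite, TruncPoly p n ⊨ φ.exs) := by
    intro m φ hφ
    have h1 : ∀ K : TotRam p, (padicStr K.1 (s K)).Models ((liftFormula p φ).closure m) ↔
        TruncPoly p (Module.finrank ℚ_[p] K.1) ⊨ φ.exs := fun K => models_closure_iff K.2 (s K) hφ
    simp only [h1]
    refine ⟨fun h => ?_, fun h => hfin.eventually h⟩
    rw [Filter.eventually_cofinite] at h ⊢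
    -- Every exceptional `n ≥ 1` is the degree of an exceptional field. No field has degree `0`, so
    -- `n = 0` is added as a possible exception.
    refine ((h.image fun K : TotRam p => Module.finrank ℚ_[p] K.1).union
      (Set.finite_singleton 0)).subset fun n hn => ?_
    rcases eq_or_ne n 0 with rfl | hn0
    · exact Or.inr rfl
    · obtain ⟨K, rfl⟩ := exists_totRam_finrank_eq (p := p) hn0
      exact Or.inl ⟨K, hn, rfl⟩
  -- Needed so that `⊥`, the image of numbers that are not codes, does not hold in all but finitely
  -- many fields.
  have : Infinite (TotRam p) := by
    choose K hK using fun n : ℕ => exists_totRam_finrank_eq (p := p) n.succ_ne_zero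
    exact Infinite.of_injective K fun m n h => by
      have h1 := hK m
      rw [h, hK n] at h1
      omega
  constructor
  · rintro ⟨φ, ⟨hφ, hev⟩, rfl⟩
    obtain ⟨m, ψ, hψ, hφψ⟩ := exists_isQF_exs_eq hφ
    change φ = ψ.exs at hφψ
    subst hφψ
    rw [reduction_code_exs p hψ]
    exact ⟨_, ⟨isSentence_closure (freeVars_liftFormula p ψ),
      (isQF_liftFormula p ψ).isExistsForall_closure m, (hiff hψ).2 hev⟩, rfl⟩
  · rintro ⟨Φ, ⟨-, -, hev⟩, hc⟩
    rcases reduction_eq_or p c with h | ⟨m, φ, hφ, rfl⟩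
    · rw [h] at hc
      rw [Formula.code_inj hc] at hev
      obtain ⟨K, hK⟩ := hev.exists
      exact (hK fun x => match x with
        | (.K, _) => (0 : K.1)
        | (.Γ, _) => (0 : WithTop (valueGroup K.1))
        | (.k, _) => (0 : ResField K.1)).elim
    · rw [reduction_code_exs p hφ] at hc
      rw [Formula.code_inj hc, hiff hφ] at hev
      exact ⟨_, ⟨isExistential_exs hφ.isExistential, hev⟩, rfl⟩

theorem corollary2p5 (p : ℕ) [Fact p.Prime]
    (s : (K : PadicExt.TotRam p) → PadicExt.CrossSection K.1) :
    TuringReducible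
      (charFun (LtP.code '' asymptoticExistentialTheory p))
      (charFun (Lval.Formula.code '' PadicExt.asymptoticExistsForallTheory s)) :=
  turingReducible_charFun (Lval.primrec_reduction p) (reduction_mem_iff p s)
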